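/- Let $G$ be an undirected connected graph on the agents $\{1,\dots,n\}$ and let $W\in\mathbb{R}^{n\times n}$ be a mixing matrix of $G$: $W$ is symmetric with entries in $[0,1]$, $W\mathbf 1=\mathbf 1$, $W_{ii}>0$ for all $i$, and for $i\ne j$, $W_{ij}>0$ if and only if $\{i,j\}$ is an edge. Put $\tilde W=W\otimes I_d$, $A=(\tilde W, I_{nd})^\top$ and $B=(I_{nd},\tilde W)^\top$, both in $\mathbb{R}^{2nd\times nd}$. Let $f_i,g_i:\mathbb{R}^d\to\mathbb{R}\cup\{+\infty\}$ $(1\le i\le n)$ be convex, and for $u=(u_1,\dots,u_n)$, $v=(v_1,\dots,v_n)\in\mathbb{R}^{nd}$ put $f(u)=\sum_{i=1}^n f_i(u_i)$ and $g(v)=\sum_{i=1}^n g_i(v_i)$. With $\partial$ the convex subdifferential (empty at points where the function is $+\infty$), define for $w=(u,v,\lambda)\in\mathbb{R}^{nd}\times\mathbb{R}^{nd}\times\mathbb{R}^{2nd}$ the KKT mapping $$T_{\mathrm{KKT}}(w)=\begin{pmatrix}\partial f(u)-A^\top\lambda\\ \partial g(v)+B^\top\lambda\\ Au-Bv\end{pmatrix},\qquad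 \Omega^*=\{w : 0\in T_{\mathrm{KKT}}(w)\}.$$ Call a function piecewise linear-quadratic (PLQ) if its effective domain is a finite union of polyhedra, on each of which it has the form $\frac12x^\top Qx+c^\top x+r$. Call a function smooth if it is finite and differentiable on all of $\mathbb{R}^d$ with locally Lipschitz continuous gradient (in particular every $C^2$ function and every differentiable function with globally Lipschitz gradient is smooth). Assume one of the following: (i) each $f_i$ is smooth and strongly convex, and each $g_i$ is PLQ; (ii) all $f_i$ and $g_i$ are PLQ; (iii) all $f_i$ and $g_i$ are smooth and strongly convex. Then for every $\bar w\in\Omega^*$ the mapping $T_{\mathrm{KKT}}$ is metrically subregular at $(\bar w,0)$: there exist $\kappa>0$ and $\varepsilon>0$ such that $$\mathrm{dist}(w,\Omega^*)\le\kappa\,\mathrm{dist}(0,T_{\mathrm{KKT}}(w))\qquad\text{for all } w \text{ with } \|w-\bar w\|<\varepsilon,$$ where distances are Euclidean and the distance to the empty set is $+\infty$. -/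

import Mathlib

/-! ### Convex analysis on Euclidean spaces, functions with values in `ℝ ∪ {+∞}` -/

/-- Convexity of an extended-valued function: its epigraph is convex. -/
def IsConvexFun {ι : Type*} (h : EuclideanSpace ℝ ι → WithTop ℝ) : Prop :=
  Convex ℝ {p : EuclideanSpace ℝ ι × ℝ | h p.1 ≤ (p.2 : WithTop ℝ)}

/-- The convex subdifferential `∂h(x)`; it is empty where `h x = +∞`. -/
def subdiff {ι : Type*} [Fintype ι] (h : EuclideanSpace ℝ ι → WithTop ℝ)
    (x : EuclideanSpace ℝ ι) : Set (EuclideanSpace ℝ ι) :=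
  {s | h x ≠ ⊤ ∧ ∀ y, h x + ((inner ℝ s (y - x) : ℝ) : WithTop ℝ) ≤ h y}

/-- A (possibly empty or unbounded) polyhedron: the solution set of finitely many affine
inequalities. -/
def IsPolyhedral {ι : Type*} [Fintype ι] (S : Set (EuclideanSpace ℝ ι)) : Prop :=
  ∃ (N : ℕ) (a : Fin N → EuclideanSpace ℝ ι) (b : Fin N → ℝ),
    S = {x | ∀ i, inner ℝ (a i) x ≤ b i}

/-- Piecewise linear-quadratic functions: the effective domain is a finite union of polyhedra,
on each of which the function is `x ↦ ½ xᵀ Q x + cᵀ x + r`. -/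
def IsPLQ {ι : Type*} [Fintype ι] [DecidableEq ι]
    (h : EuclideanSpace ℝ ι → WithTop ℝ) : Prop :=
  ∃ (N : ℕ) (P : Fin N → Set (EuclideanSpace ℝ ι)),
    (∀ j, IsPolyhedral (P j)) ∧ {x | h x ≠ ⊤} = ⋃ j, P j ∧
    ∀ j, ∃ (Q : Matrix ι ι ℝ) (c : EuclideanSpace ℝ ι) (r : ℝ), ∀ x ∈ P j,
      h x = ((1 / 2 * inner ℝ x (Matrix.toEuclideanLin Q x) + inner ℝ c x + r : ℝ) : WithTop ℝ)

/-- Smooth and strongly convex: finite everywhere, differentiable with locally Lipschitz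
gradient, and strongly convex with some modulus `m > 0`. -/
def IsSmoothStronglyConvex {ι : Type*} [Fintype ι]
    (h : EuclideanSpace ℝ ι → WithTop ℝ) : Prop :=
  ∃ φ : EuclideanSpace ℝ ι → ℝ, (∀ x, h x = (φ x : WithTop ℝ)) ∧
    Differentiable ℝ φ ∧ LocallyLipschitz (gradient φ) ∧
    ∃ m : ℝ, 0 < m ∧ StrongConvexOn Set.univ m φ

/-! ### Metric subregularity -/

/-- The set-valued map `Ψ` is metrically subregular at `(x₀, y₀) ∈ gph Ψ`. Distances are
`[0, ∞]`-valued, so that the distance to the empty set is `+∞`. -/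
def IsMetricallySubregularAt {X Y : Type*} [PseudoMetricSpace X] [PseudoMetricSpace Y]
    (Ψ : X → Set Y) (x₀ : X) (y₀ : Y) : Prop :=
  y₀ ∈ Ψ x₀ ∧ ∃ κ : ℝ, 0 < κ ∧ ∃ ε : ℝ, 0 < ε ∧ ∀ x ∈ Metric.ball x₀ ε,
    Metric.infEDist x {z | y₀ ∈ Ψ z} ≤ ENNReal.ofReal κ * Metric.infEDist y₀ (Ψ x)

/-! ### The decentralized problem -/

/-- `W` is a mixing matrix of the graph `G` on the agents. -/
structure IsMixingMatrix {n : ℕ} (G : SimpleGraph (Fin n)) (W : Matrix (Fin n) (Fin n) ℝ) :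
    Prop where
  mem_Icc : ∀ i j, W i j ∈ Set.Icc (0 : ℝ) 1
  symm : W.IsSymm
  mulVec_one : W.mulVec 1 = 1
  pos_iff : ∀ i j, i ≠ j → (0 < W i j ↔ G.Adj i j)
  diag_pos : ∀ i, 0 < W i i

/-- Index set of the coordinates of `ℝ^{nd}`: agent, then coordinate in `ℝ^d`. -/
abbrev StackIdx (n d : ℕ) : Type := Fin n × Fin d

/-- The space `ℝ^{nd}` of stacked local variables. -/
abbrev StackSpace (n d : ℕ) : Type := EuclideanSpace ℝ (StackIdx n d)

/-- The space `ℝ^{2nd}` of multipliers. -/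
abbrev MultSpace (n d : ℕ) : Type := EuclideanSpace ℝ (StackIdx n d ⊕ StackIdx n d)

/-- The space `ℝ^{4nd}` of triples `(u, v, λ)`, with the Euclidean norm. -/
abbrev KKTSpace (n d : ℕ) : Type :=
  WithLp 2 (StackSpace n d × WithLp 2 (StackSpace n d × MultSpace n d))

/-- The local variable `u_i ∈ ℝ^d` of agent `i`. -/
def localVar {n d : ℕ} (u : StackSpace n d) (i : Fin n) : EuclideanSpace ℝ (Fin d) :=
  WithLp.toLp 2 fun k => u (i, k)

/-- The separable sum `u ↦ ∑ i, f_i(u_i)`. -/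
def separableSum {n d : ℕ} (f : Fin n → EuclideanSpace ℝ (Fin d) → WithTop ℝ)
    (u : StackSpace n d) : WithTop ℝ :=
  ∑ i, f i (localVar u i)

/-- `W̃ = W ⊗ I_d`. -/
def mixTilde {n : ℕ} (d : ℕ) (W : Matrix (Fin n) (Fin n) ℝ) :
    Matrix (StackIdx n d) (StackIdx n d) ℝ :=
  Matrix.kronecker W (1 : Matrix (Fin d) (Fin d) ℝ)

/-- `A = (W̃, I)ᵀ`. -/
def matA {n : ℕ} (d : ℕ) (W : Matrix (Fin n) (Fin n) ℝ) :
    Matrix (StackIdx n d ⊕ StackIdx n d) (StackIdx n d) ℝ :=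
  (Matrix.fromCols (mixTilde d W) 1).transpose

/-- `B = (I, W̃)ᵀ`. -/
def matB {n : ℕ} (d : ℕ) (W : Matrix (Fin n) (Fin n) ℝ) :
    Matrix (StackIdx n d ⊕ StackIdx n d) (StackIdx n d) ℝ :=
  (Matrix.fromCols 1 (mixTilde d W)).transpose

/-- The KKT mapping `T(u, v, λ) = (∂f(u) - Aᵀ λ) × (∂g(v) + Bᵀ λ) × {A u - B v}` of the problem
`min f(u) + g(v)` subject to `A u - B v = 0`. -/
def kktMap {n d : ℕ} (W : Matrix (Fin n) (Fin n) ℝ)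
    (f g : Fin n → EuclideanSpace ℝ (Fin d) → WithTop ℝ) (w : KKTSpace n d) :
    Set (KKTSpace n d) :=
  let u := w.fst
  let v := w.snd.fst
  let lam := w.snd.snd
  {y | ∃ s ∈ subdiff (separableSum f) u, ∃ t ∈ subdiff (separableSum g) v,
    y.fst = s - Matrix.toEuclideanLin (matA d W).transpose lam ∧
    y.snd.fst = t + Matrix.toEuclideanLin (matB d W).transpose lam ∧
    y.snd.snd = Matrix.toEuclideanLin (matA d W) u - Matrix.toEuclideanLin (matB d W) v}

/-- The solution set `Ω* = {w | 0 ∈ T(w)}`. -/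
def kktSolutions {n d : ℕ} (W : Matrix (Fin n) (Fin n) ℝ)
    (f g : Fin n → EuclideanSpace ℝ (Fin d) → WithTop ℝ) : Set (KKTSpace n d) :=
  {w | 0 ∈ kktMap W f g w}

/-! ### Polyhedra and Fourier–Motzkin elimination -/

/-! Lift the optimality system to points `((u, s), (v, t), λ)` with `s ∈ ∂f(u)` and `t ∈ ∂g(v)`. The
residual is then a linear map `T`, and the solutions are the points of `gph ∂f × gph ∂g × ℝ^{2nd}`
on which `T` vanishes. If both graphs are finite unions of polyhedra, Hoffman's bound, piece by
piece, bounds the distance to a solution near a given one by a multiple of `‖T z‖`. This settles the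
PLQ case once the graph of a convex PLQ subdifferential is shown to be such a union
(`IsPLQ.isPolyUnion_subdiff`).

The graph of a smooth strongly convex gradient is not polyhedral, but its `u`-component is
determined by strong monotonicity. `HasPolyhedralModel` covers both cases: near `p`, a point of the
graph is within `L * ρ` of a polyhedral subset `S`, and `ρ ^ 2` is at most the monotonicity pairing
with every point of `S`. For PLQ functions `S` is the whole graph and `ρ = 0`; for smooth strongly
convex ones `S = {p}` and `ρ` is a multiple of `‖u - ū‖`. Models pass to separable sums.

In `kktResidual_error_bound`, with `η = ‖T z‖` and `σ` the sum of the two `ρ`'s, Hoffman's bound on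
the models gives a solution `z'` with `‖z - z'‖ ≤ c (η + σ)`. The `A` and `B` terms cancel in the
pairing of `z - z'`, so `σ ^ 2 ≤ 6 c η (η + σ)`. Hence `σ` is itself `O(η)`, and the bound closes.
-/

/-- A polyhedron in a real vector space: the solution set of finitely many affine inequalities. -/
def IsPolyhedron {V : Type*} [AddCommGroup V] [Module ℝ V] (S : Set V) : Prop :=
  ∃ (ι : Type) (_ : Finite ι) (a : ι → V →ₗ[ℝ] ℝ) (b : ι → ℝ), S = {x | ∀ i, a i x ≤ b i}

section FourierMotzkin

variable {V : Type*} [AddCommGroup V] [Module ℝ V] {ι : Type}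

open Classical in
/-- The functionals of the Fourier–Motzkin elimination of `t` from `a i x + α i * t ≤ b i`. -/
noncomputable def elimFun (a : ι → V →ₗ[ℝ] ℝ) (α : ι → ℝ) : ι ⊕ ι × ι → V →ₗ[ℝ] ℝ
  | .inl i => if α i = 0 then a i else 0
  | .inr (i, j) => if 0 < α i ∧ α j < 0 then α i • a j - α j • a i else 0

open Classical in
/-- The right-hand sides of the Fourier–Motzkin elimination of `t` from
`a i x + α i * t ≤ b i`. -/
noncomputable def elimRhs (b : ι → ℝ) (α : ι → ℝ) : ι ⊕ ι × ι → ℝ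
  | .inl i => if α i = 0 then b i else 0
  | .inr (i, j) => if 0 < α i ∧ α j < 0 then α i * b j - α j * b i else 0

/-- Each eliminated row is either an original row or a combination of two rows with nonnegative
weights at most `M`, so a slack `r` grows at most to `(1 + 2 * M) * r`. The other indices carry the
padding `0 ≤ 0`. -/
theorem elimFun_le_of_le {a : ι → V →ₗ[ℝ] ℝ} {α b : ι → ℝ} {x : V} {t r M : ℝ} (hr : 0 ≤ r)
    (hM : ∀ i, |α i| ≤ M) (h : ∀ i, a i x + α i * t ≤ b i + r) (k : ι ⊕ ι × ι) :
    elimFun a α k x ≤ elimRhs b α k + (1 + 2 * M) * r := by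
  obtain i | ⟨i, j⟩ := k
  · have hM0 : 0 ≤ M := (abs_nonneg _).trans (hM i)
    simp only [elimFun, elimRhs]
    split_ifs with h0
    · have := h i
      rw [h0] at this
      nlinarith [mul_nonneg hM0 hr]
    · simp only [LinearMap.zero_apply]
      positivity
  · have hM0 : 0 ≤ M := (abs_nonneg _).trans (hM i)
    simp only [elimFun, elimRhs]
    split_ifs with h0
    · obtain ⟨hi, hj⟩ := h0
      have h1 := mul_le_mul_of_nonneg_left (h j) hi.le
      have h2 := mul_le_mul_of_nonneg_left (h i) (neg_nonneg.2 hj.le)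
      have h3 := mul_le_mul_of_nonneg_right ((le_abs_self _).trans (hM i)) hr
      have h4 := mul_le_mul_of_nonneg_right ((neg_le_abs _).trans (hM j)) hr
      simp only [LinearMap.sub_apply, LinearMap.smul_apply, smul_eq_mul]
      nlinarith
    · simp only [LinearMap.zero_apply]
      positivity

/-- The rows with `α i ≠ 0` bound `t'` from below or above, and the eliminated system says that
every lower bound is at most every upper bound. Adding `t - δ` and `t + δ` to the two families keeps
this true and places `t'` within `δ` of `t`. -/
theorem exists_of_elimFun_le {a : ι → V →ₗ[ℝ] ℝ} {α b : ι → ℝ} {x : V} {t δ : ℝ} (hδ : 0 ≤ δ)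
    (hx : ∀ k, elimFun a α k x ≤ elimRhs b α k)
    (h : ∀ i, α i ≠ 0 → a i x + α i * t ≤ b i + |α i| * δ) :
    ∃ t', |t' - t| ≤ δ ∧ ∀ i, a i x + α i * t' ≤ b i := by
  obtain ⟨t', h1, h2⟩ := exists_between_of_forall_le
    (s := insert (t - δ) {l | ∃ j, α j < 0 ∧ l = (b j - a j x) / α j})
    (t := insert (t + δ) {u | ∃ i, 0 < α i ∧ u = (b i - a i x) / α i})
    (Set.insert_nonempty _ _) (Set.insert_nonempty _ _) (by
      rintro l (rfl | ⟨j, hj, rfl⟩) u (rfl | ⟨i, hi, rfl⟩)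
      · linarith
      · have := h i hi.ne'
        rw [abs_of_pos hi] at this
        rw [le_div_iff₀ hi]
        nlinarith
      · have := h j hj.ne
        rw [abs_of_neg hj] at this
        rw [div_le_iff_of_neg hj]
        nlinarith
      · have := hx (.inr (i, j))
        simp only [elimFun, elimRhs, hi, hj, and_self, if_true, LinearMap.sub_apply,
          LinearMap.smul_apply, smul_eq_mul] at this
        rw [div_le_iff_of_neg hj, div_mul_eq_mul_div, div_le_iff₀ hi]
        nlinarith)
  refine ⟨t', abs_le.2 ⟨by linarith [h1 (Set.mem_insert _ _)],
    by linarith [h2 (Set.mem_insert _ _)]⟩, fun i => ?_⟩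
  rcases lt_trichotomy (α i) 0 with hi | hi | hi
  · have := h1 (Set.mem_insert_of_mem _ ⟨i, hi, rfl⟩)
    rw [div_le_iff_of_neg hi] at this
    linarith
  · have := hx (.inl i)
    simp only [elimFun, elimRhs, hi, if_true] at this
    rw [hi]
    linarith
  · have := h2 (Set.mem_insert_of_mem _ ⟨i, hi, rfl⟩)
    rw [le_div_iff₀ hi] at this
    linarith

theorem IsPolyhedron.fst_image {S : Set (V × ℝ)} (hS : IsPolyhedron S) :
    IsPolyhedron {x | ∃ t, (x, t) ∈ S} := by
  obtain ⟨ι, hι, a, b, rfl⟩ := hS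
  have := Fintype.ofFinite ι
  set a' : ι → V →ₗ[ℝ] ℝ := fun i => (a i).comp (LinearMap.inl ℝ V ℝ)
  set α : ι → ℝ := fun i => a i (0, 1)
  have key : ∀ i x t, a i (x, t) = a' i x + α i * t := fun i x t => by
    have : ((x, t) : V × ℝ) = (x, 0) + t • (0, 1) := by simp
    rw [this, map_add, map_smul, smul_eq_mul, mul_comm]
    rfl
  refine ⟨ι ⊕ ι × ι, inferInstance, elimFun a' α, elimRhs b α, ?_⟩
  ext x
  simp only [Set.mem_ofPred_eq, key]
  constructor
  · rintro ⟨t, ht⟩ k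
    have := elimFun_le_of_le (r := 0) (M := ∑ i, |α i|) le_rfl
      (fun i => Finset.single_le_sum (f := fun i => |α i|) (fun _ _ => abs_nonneg _)
        (Finset.mem_univ i)) (fun i => by simpa using ht i) k
    simpa using this
  · intro hx
    have hnn : ∀ i, 0 ≤ |a' i x - b i| / |α i| := fun i => by positivity
    -- Only existence matters here: `δ` is so large that the violation at `t = 0` is admissible.
    obtain ⟨t, -, ht⟩ := exists_of_elimFun_le (t := 0) (δ := ∑ i, |a' i x - b i| / |α i|)
      (Finset.sum_nonneg fun i _ => hnn i) hx (fun i hi => by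
        have h1 := Finset.single_le_sum (fun i _ => hnn i) (Finset.mem_univ i)
        have h2 := mul_le_mul_of_nonneg_left h1 (abs_nonneg (α i))
        rw [mul_div_cancel₀ _ (abs_ne_zero.2 hi)] at h2
        linarith [le_abs_self (a' i x - b i)])
    exact ⟨t, ht⟩

end FourierMotzkin

/-! ### Closure properties of polyhedra -/

section Closure

variable {V W : Type*} [AddCommGroup V] [Module ℝ V] [AddCommGroup W] [Module ℝ W]

theorem IsPolyhedron.preimage {S : Set W} (hS : IsPolyhedron S) (T : V →ₗ[ℝ] W) (c : W) :
    IsPolyhedron {x | T x + c ∈ S} := by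
  obtain ⟨ι, hι, a, b, rfl⟩ := hS
  refine ⟨ι, hι, fun i => (a i).comp T, fun i => b i - a i c, ?_⟩
  ext x
  simp [le_sub_iff_add_le]

theorem IsPolyhedron.congr {S T : Set V} (hS : IsPolyhedron S) (h : ∀ x, x ∈ S ↔ x ∈ T) :
    IsPolyhedron T :=
  Set.ext h ▸ hS

theorem IsPolyhedron.iInter {κ : Type} [Finite κ] {S : κ → Set V}
    (hS : ∀ k, IsPolyhedron (S k)) : IsPolyhedron (⋂ k, S k) := by
  choose ι hι a b h using hS
  refine ⟨Σ k, ι k, inferInstance, fun p => a p.1 p.2, fun p => b p.1 p.2, ?_⟩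
  ext x
  simp [h, Sigma.forall]

theorem isPolyhedron_halfspace (a : V →ₗ[ℝ] ℝ) (b : ℝ) : IsPolyhedron {x | a x ≤ b} :=
  ⟨Unit, inferInstance, fun _ => a, fun _ => b, by simp⟩

theorem isPolyhedron_univ : IsPolyhedron (Set.univ : Set V) :=
  ⟨Empty, inferInstance, fun _ => 0, fun _ => 0, by simp⟩

theorem IsPolyhedron.inter {S T : Set V} (hS : IsPolyhedron S) (hT : IsPolyhedron T) :
    IsPolyhedron (S ∩ T) := by
  rw [Set.inter_eq_iInter]
  exact IsPolyhedron.iInter fun b => by cases b <;> assumption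

theorem isPolyhedron_ker_functional (a : V →ₗ[ℝ] ℝ) (b : ℝ) : IsPolyhedron {x | a x = b} := by
  convert! (isPolyhedron_halfspace a b).inter (isPolyhedron_halfspace (-a) (-b)) using 1
  ext x
  simp [le_antisymm_iff]

theorem IsPolyhedron.imp {S : Set V} (p : Prop) (hS : IsPolyhedron S) :
    IsPolyhedron {x | p → x ∈ S} := by
  by_cases hp : p
  · simpa [hp] using hS
  · simpa [hp] using isPolyhedron_univ

theorem IsPolyhedron.forall {κ : Type} [Finite κ] {p : κ → V → Prop}
    (h : ∀ k, IsPolyhedron {x | p k x}) : IsPolyhedron {x | ∀ k, p k x} := by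
  rw [Set.ofPred_forall]
  exact IsPolyhedron.iInter h

theorem IsPolyhedron.isClosed {V : Type*} [NormedAddCommGroup V] [NormedSpace ℝ V]
    [FiniteDimensional ℝ V] {S : Set V} (hS : IsPolyhedron S) : IsClosed S := by
  obtain ⟨ι, hι, a, b, rfl⟩ := hS
  rw [Set.ofPred_forall]
  exact isClosed_iInter fun i =>
    isClosed_le (LinearMap.continuous_of_finiteDimensional (a i)) continuous_const

theorem isPolyhedron_singleton [FiniteDimensional ℝ V] (v : V) : IsPolyhedron ({v} : Set V) := by
  let e := Module.finBasis ℝ V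
  have := IsPolyhedron.forall (κ := Fin (Module.finrank ℝ V))
    (p := fun k x => e.coord k x = e.coord k v) (fun k => isPolyhedron_ker_functional _ _)
  convert! this using 1
  ext x
  simp [e.ext_elem_iff]

/-- Finitely generated cones are polyhedral (Weyl's theorem). -/
theorem isPolyhedron_hull [FiniteDimensional ℝ V] {s : Set V} (hs : s.Finite) :
    IsPolyhedron (PointedCone.hull ℝ s : Set V) := by
  induction s, hs using Set.Finite.induction_on with
  | empty => simpa [PointedCone.hull] using isPolyhedron_singleton (0 : V)
  | @insert v s _ _ ih =>
    -- Adjoining a generator `v` to a cone is the projection along the coefficient of `v` of this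
    -- polyhedron.
    have h1 : IsPolyhedron {p : V × ℝ | p.1 - p.2 • v ∈ PointedCone.hull ℝ s ∧ 0 ≤ p.2} := by
      have h2 := (ih.preimage (LinearMap.fst ℝ V ℝ - (LinearMap.snd ℝ V ℝ).smulRight v) 0).inter
        (isPolyhedron_halfspace (-LinearMap.snd ℝ V ℝ) 0)
      convert! h2 using 1
      ext p
      simp
    convert! h1.fst_image using 1
    ext x
    simp only [PointedCone.hull, SetLike.mem_coe, Submodule.mem_span_insert, Set.mem_ofPred_eq]
    constructor
    · rintro ⟨c, z, hz, rfl⟩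
      refine ⟨c, ?_, c.2⟩
      change c • v + z - c • v ∈ _
      rwa [add_sub_cancel_left]
    · rintro ⟨t, hz, ht⟩
      exact ⟨⟨t, ht⟩, _, hz, (add_sub_cancel (t • v) x).symm⟩

/-- Farkas' lemma. -/
theorem exists_functional_of_notMem_hull [FiniteDimensional ℝ V] {s : Set V} (hs : s.Finite)
    {v : V} (hv : v ∉ PointedCone.hull ℝ s) :
    ∃ c : V →ₗ[ℝ] ℝ, (∀ x ∈ s, c x ≤ 0) ∧ 0 < c v := by
  obtain ⟨ι, _, a, b, h⟩ := isPolyhedron_hull hs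
  have hmem : ∀ x, x ∈ PointedCone.hull ℝ s ↔ ∀ i, a i x ≤ b i := fun x => by
    rw [← SetLike.mem_coe, h]; rfl
  rw [hmem] at hv
  push Not at hv
  obtain ⟨i, hi⟩ := hv
  have h0 := (hmem 0).1 (zero_mem _) i
  rw [map_zero] at h0
  refine ⟨a i, fun x hx => ?_, h0.trans_lt hi⟩
  by_contra! hpos
  -- A functional positive on a generator would exceed any bound `b i` on the ray through it.
  have hx' := (hmem _).1 ((PointedCone.hull ℝ s).smul_mem
    (r := (b i + 1) / a i x) (by positivity) (Submodule.subset_span hx)) i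
  rw [map_smul, smul_eq_mul, div_mul_cancel₀ _ hpos.ne'] at hx'
  linarith

end Closure

/-! ### Hoffman's error bound -/

/-- Hoffman's error bound holds for all finite systems of affine inequalities on `V`, with a
constant that does not depend on the right-hand side. -/
def HoffmanBound (V : Type*) [NormedAddCommGroup V] [NormedSpace ℝ V] : Prop :=
  ∀ (ι : Type) [Finite ι] (a : ι → V →ₗ[ℝ] ℝ), ∃ κ : ℝ, 0 ≤ κ ∧ ∀ b : ι → ℝ,
    (∃ x, ∀ i, a i x ≤ b i) → ∀ x r, 0 ≤ r → (∀ i, a i x ≤ b i + r) →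
      ∃ p, (∀ i, a i p ≤ b i) ∧ ‖x - p‖ ≤ κ * r

section Hoffman

variable {V W : Type*} [NormedAddCommGroup V] [NormedSpace ℝ V] [NormedAddCommGroup W]
  [NormedSpace ℝ W]

theorem HoffmanBound.congr (h : HoffmanBound V) (e : V ≃L[ℝ] W) : HoffmanBound W := by
  intro ι _ a
  obtain ⟨κ, hκ, H⟩ := h ι fun i => (a i).comp (e : V →ₗ[ℝ] W)
  refine ⟨‖(e : V →L[ℝ] W)‖ * κ, by positivity, fun b ⟨x₀, hx₀⟩ x r hr hx => ?_⟩
  obtain ⟨p, hp, hxp⟩ := H b ⟨e.symm x₀, by simpa using hx₀⟩ (e.symm x) r hr (by simpa using hx)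
  refine ⟨e p, hp, ?_⟩
  calc ‖x - e p‖ = ‖(e : V →L[ℝ] W) (e.symm x - p)‖ := by simp
    _ ≤ ‖(e : V →L[ℝ] W)‖ * ‖e.symm x - p‖ := ContinuousLinearMap.le_opNorm _ _
    _ ≤ ‖(e : V →L[ℝ] W)‖ * κ * r := by rw [mul_assoc]; gcongr

theorem hoffmanBound_of_subsingleton [Subsingleton V] : HoffmanBound V :=
  fun _ _ _ => ⟨0, le_rfl, fun _ ⟨p, hp⟩ x _ _ _ =>
    ⟨p, hp, by simp [Subsingleton.elim x p]⟩⟩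

/-- Eliminate the last coordinate, correct `x` to `p` by the bound for the eliminated system, then
correct `t`. The eliminated functionals do not involve the right-hand side, so neither does the
constant. -/
theorem HoffmanBound.prod_real [FiniteDimensional ℝ V] (h : HoffmanBound V) :
    HoffmanBound (V × ℝ) := by
  intro ι _ a
  have := Fintype.ofFinite ι
  set a' : ι → V →ₗ[ℝ] ℝ := fun i => (a i).comp (LinearMap.inl ℝ V ℝ)
  set α : ι → ℝ := fun i => a i (0, 1)
  have key : ∀ i x t, a i (x, t) = a' i x + α i * t := fun i x t => by
    have : ((x, t) : V × ℝ) = (x, 0) + t • (0, 1) := by simp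
    rw [this, map_add, map_smul, smul_eq_mul, mul_comm]
    rfl
  obtain ⟨κ, hκ, H⟩ := h _ (elimFun a' α)
  set M := ∑ i, |α i|
  have hM : ∀ i, |α i| ≤ M := fun i => Finset.single_le_sum (f := fun i => |α i|)
    (fun _ _ => abs_nonneg _) (Finset.mem_univ i)
  have hM0 : 0 ≤ M := Finset.sum_nonneg fun _ _ => abs_nonneg _
  set N := ∑ i, ‖LinearMap.toContinuousLinearMap (a' i)‖
  have hN : ∀ i x, |a' i x| ≤ N * ‖x‖ := fun i x =>
    (ContinuousLinearMap.le_opNorm (LinearMap.toContinuousLinearMap (a' i)) x).trans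
      (mul_le_mul_of_nonneg_right (Finset.single_le_sum
        (f := fun i => ‖LinearMap.toContinuousLinearMap (a' i)‖) (fun _ _ => norm_nonneg _)
        (Finset.mem_univ i)) (norm_nonneg _))
  have hN0 : 0 ≤ N := Finset.sum_nonneg fun _ _ => norm_nonneg _
  set κ₁ := κ * (1 + 2 * M)
  set I := ∑ i, |α i|⁻¹
  have hI0 : 0 ≤ I := Finset.sum_nonneg fun _ _ => by positivity
  refine ⟨max κ₁ ((1 + N * κ₁) * I), le_max_of_le_left (by positivity), ?_⟩
  rintro b ⟨⟨x₀, t₀⟩, h₀⟩ ⟨x, t⟩ r hr hx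
  simp only [key] at h₀ hx
  obtain ⟨p, hp, hxp⟩ := H (elimRhs b α) ⟨x₀, fun k => by
    simpa using elimFun_le_of_le (r := 0) le_rfl hM (by simpa using h₀) k⟩ x ((1 + 2 * M) * r)
    (by positivity) (elimFun_le_of_le hr hM hx)
  rw [← mul_assoc] at hxp
  -- Replacing `x` by `p` changes each row by at most `N * κ₁ * r`, so the violation is at most `(1
  -- + N * κ₁) * r`; the factor `I` dominates every `|α i|⁻¹`.
  obtain ⟨t', ht', hpt⟩ := exists_of_elimFun_le (t := t) (δ := (1 + N * κ₁) * I * r)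
    (by positivity) hp (fun i hi => by
      have h1 : a' i p ≤ a' i x + N * (κ₁ * r) := by
        have h2 := hN i (x - p)
        rw [map_sub] at h2
        have h3 := mul_le_mul_of_nonneg_left hxp hN0
        linarith [neg_abs_le (a' i x - a' i p)]
      have h2 : 1 ≤ |α i| * I := by
        rw [← mul_inv_cancel₀ (abs_ne_zero.2 hi)]
        exact mul_le_mul_of_nonneg_left (Finset.single_le_sum (f := fun i => |α i|⁻¹)
          (fun _ _ => by positivity) (Finset.mem_univ i)) (abs_nonneg _)
      have h3 : 0 ≤ (1 + N * κ₁) * r := by positivity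
      have h4 := mul_le_mul_of_nonneg_right h2 h3
      have h5 := hx i
      nlinarith)
  refine ⟨(p, t'), fun i => (key i p t').trans_le (hpt i), ?_⟩
  rw [Prod.mk_sub_mk, Prod.norm_mk, max_mul_of_nonneg _ _ hr, Real.norm_eq_abs, abs_sub_comm t]
  exact max_le_max hxp ht'

theorem hoffmanBound_of_finiteDimensional [FiniteDimensional ℝ V] : HoffmanBound V := by
  have h : ∀ n, HoffmanBound (Fin n → ℝ) := fun n => by
    induction n with
    | zero => exact hoffmanBound_of_subsingleton
    | succ n ih =>
      exact ih.prod_real.congr ((ContinuousLinearEquiv.prodComm ℝ _ _).trans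
        (Fin.consEquivL ℝ fun _ : Fin (n + 1) => ℝ))
  exact (h (Module.finrank ℝ V)).congr (ContinuousLinearEquiv.ofFinrankEq (by simp))

/-- Linear regularity of a polyhedron and a linear subspace. -/
theorem IsPolyhedron.error_bound [FiniteDimensional ℝ V] [FiniteDimensional ℝ W] {P : Set V}
    (hP : IsPolyhedron P) (T : V →L[ℝ] W) (hne : ∃ z ∈ P, T z = 0) :
    ∃ κ : ℝ, 0 ≤ κ ∧ ∀ z ∈ P, ∃ p ∈ P, T p = 0 ∧ ‖z - p‖ ≤ κ * ‖T z‖ := by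
  obtain ⟨ι, _, a, b, rfl⟩ := hP
  obtain ⟨z₀, hz₀, hTz₀⟩ := hne
  let e := Module.finBasis ℝ W
  let c : Fin (Module.finrank ℝ W) → V →ₗ[ℝ] ℝ := fun k => (e.coord k).comp (T : V →ₗ[ℝ] W)
  -- The equation `T z = 0` enters as opposite pairs of coordinate inequalities, violated at `z` by
  -- at most `N * ‖T z‖`.
  obtain ⟨κ, hκ, H⟩ := hoffmanBound_of_finiteDimensional (V := V) _
    (Sum.elim a (Sum.elim c fun k => -c k))
  set N := ∑ k, ‖LinearMap.toContinuousLinearMap (e.coord k)‖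
  have hN0 : 0 ≤ N := Finset.sum_nonneg fun _ _ => norm_nonneg _
  have hN : ∀ k z, |c k z| ≤ N * ‖T z‖ := fun k z =>
    (ContinuousLinearMap.le_opNorm (LinearMap.toContinuousLinearMap (e.coord k)) (T z)).trans
      (mul_le_mul_of_nonneg_right (Finset.single_le_sum
        (f := fun k => ‖LinearMap.toContinuousLinearMap (e.coord k)‖) (fun _ _ => norm_nonneg _)
        (Finset.mem_univ k)) (norm_nonneg _))
  refine ⟨κ * N, by positivity, fun z hz => ?_⟩
  obtain ⟨p, hp, hzp⟩ := H (Sum.elim b fun _ => 0) ⟨z₀, by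
      rintro (i | k | k)
      · exact hz₀ i
      · simp [c, hTz₀]
      · simp [c, hTz₀]⟩ z (N * ‖T z‖) (by positivity) (by
      rintro (i | k | k)
      · exact (hz i).trans (le_add_of_nonneg_right (by positivity))
      · simpa using (le_abs_self _).trans (hN k z)
      · simpa using (neg_le_abs _).trans (hN k z))
  refine ⟨p, fun i => hp (.inl i), ?_, by rwa [mul_assoc]⟩
  rw [← e.forall_coord_eq_zero_iff]
  intro k
  have h1 := hp (.inr (.inl k))
  have h2 := hp (.inr (.inr k))
  simp only [Sum.elim_inr, Sum.elim_inl, LinearMap.neg_apply] at h1 h2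
  exact le_antisymm h1 (neg_nonpos.1 h2)

end Hoffman

/-! ### Finite unions of polyhedra -/

/-- Finite unions of polyhedra. -/
def IsPolyUnion {V : Type*} [AddCommGroup V] [Module ℝ V] (S : Set V) : Prop :=
  ∃ (κ : Type) (_ : Finite κ) (P : κ → Set V), (∀ k, IsPolyhedron (P k)) ∧ S = ⋃ k, P k

section PolyUnion

variable {V W : Type*} [AddCommGroup V] [Module ℝ V] [AddCommGroup W] [Module ℝ W]

theorem IsPolyhedron.isPolyUnion {S : Set V} (hS : IsPolyhedron S) : IsPolyUnion S :=
  ⟨Unit, inferInstance, fun _ => S, fun _ => hS, (Set.iUnion_const S).symm⟩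

theorem IsPolyUnion.preimage {S : Set W} (hS : IsPolyUnion S) (T : V →ₗ[ℝ] W) :
    IsPolyUnion (T ⁻¹' S) := by
  obtain ⟨κ, hκ, P, hP, rfl⟩ := hS
  refine ⟨κ, hκ, fun k => T ⁻¹' P k, fun k => ?_, Set.preimage_iUnion⟩
  have := (hP k).preimage T 0
  simp only [add_zero] at this
  exact this

theorem IsPolyUnion.iInter {ι : Type} [Finite ι] {S : ι → Set V} (hS : ∀ i, IsPolyUnion (S i)) :
    IsPolyUnion (⋂ i, S i) := by
  choose κ hκ P hP h using hS
  refine ⟨∀ i, κ i, inferInstance, fun k => ⋂ i, P i (k i),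
    fun k => IsPolyhedron.iInter fun i => hP i (k i), ?_⟩
  ext x
  simp only [h, Set.mem_iInter, Set.mem_iUnion]
  exact Classical.skolem

theorem IsPolyUnion.inter {S T : Set V} (hS : IsPolyUnion S) (hT : IsPolyUnion T) :
    IsPolyUnion (S ∩ T) := by
  rw [Set.inter_eq_iInter]
  exact IsPolyUnion.iInter fun b => by cases b <;> assumption

/-- Local linear regularity of a finite union of polyhedra and a linear subspace. -/
theorem IsPolyUnion.local_error_bound {V W : Type*} [NormedAddCommGroup V] [NormedSpace ℝ V]
    [NormedAddCommGroup W] [NormedSpace ℝ W] [FiniteDimensional ℝ V] [FiniteDimensional ℝ W]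
    {S : Set V} (hS : IsPolyUnion S) (T : V →L[ℝ] W) {z₀ : V} (hT : T z₀ = 0) :
    ∃ κ : ℝ, 0 ≤ κ ∧ ∃ ε : ℝ, 0 < ε ∧ ∀ z ∈ S, ‖z - z₀‖ < ε →
      ∃ p ∈ S, T p = 0 ∧ ‖z - p‖ ≤ κ * ‖T z‖ := by
  obtain ⟨ι, _, P, hP, rfl⟩ := hS
  have := Fintype.ofFinite ι
  have h1 : ∀ i, ∃ κ : ℝ, 0 ≤ κ ∧ ∀ᶠ z in nhds z₀, z ∈ P i →
      ∃ p ∈ P i, T p = 0 ∧ ‖z - p‖ ≤ κ * ‖T z‖ := fun i => by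
    by_cases h0 : z₀ ∈ P i
    · obtain ⟨κ, hκ, H⟩ := (hP i).error_bound T ⟨z₀, h0, hT⟩
      exact ⟨κ, hκ, Filter.Eventually.of_forall H⟩
    -- A closed piece that misses `z₀` misses a neighbourhood of it.
    · refine ⟨0, le_rfl, ?_⟩
      filter_upwards [(hP i).isClosed.isOpen_compl.mem_nhds h0] with z hz hz'
      exact absurd hz' hz
  choose κ hκ H using h1
  obtain ⟨ε, hε, hball⟩ := Metric.eventually_nhds_iff.1 (Filter.eventually_all.2 H)
  refine ⟨∑ i, κ i, Finset.sum_nonneg fun i _ => hκ i, ε, hε, fun z hz hzε => ?_⟩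
  obtain ⟨i, hi⟩ := Set.mem_iUnion.1 hz
  obtain ⟨p, hp, hTp, hzp⟩ := hball (by rwa [dist_eq_norm]) i hi
  exact ⟨p, Set.mem_iUnion.2 ⟨i, hp⟩, hTp, hzp.trans (mul_le_mul_of_nonneg_right
    (Finset.single_le_sum (fun i _ => hκ i) (Finset.mem_univ i)) (norm_nonneg _))⟩

end PolyUnion

/-! ### Subdifferentials of convex piecewise linear-quadratic functions -/

theorem IsConvexFun.le_real {ι : Type*} {h : EuclideanSpace ℝ ι → WithTop ℝ}
    (hh : IsConvexFun h) {x y : EuclideanSpace ℝ ι} {a b t : ℝ}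
    (hx : h x = a) (hy : h y = b) (h0 : 0 ≤ t) (h1 : t ≤ 1) :
    h (x + t • (y - x)) ≤ ((a + t * (b - a) : ℝ) : WithTop ℝ) := by
  have := hh (x := (x, a)) hx.le (y := (y, b)) hy.le (sub_nonneg.2 h1) h0 (by ring)
  change h ((1 - t) • x + t • y) ≤ (((1 - t) • a + t • b : ℝ) : WithTop ℝ) at this
  have h2 : x + t • (y - x) = (1 - t) • x + t • y := by module
  have h3 : a + t * (b - a) = (1 - t) • a + t • b := by simp only [smul_eq_mul]; ring
  rwa [h2, h3]

section Subdiff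

variable {ι : Type*} [Fintype ι] {h : EuclideanSpace ℝ ι → WithTop ℝ}

theorem coe_add_inner_le {x y s : EuclideanSpace ℝ ι} (hs : s ∈ subdiff h x) {a b : ℝ}
    (hx : h x = a) (hy : h y = b) : a + inner ℝ s (y - x) ≤ b := by
  have := hs.2 y
  rw [hx, hy] at this
  exact_mod_cast this

theorem mem_subdiff_of_real {x s : EuclideanSpace ℝ ι} {a : ℝ} (hx : h x = a)
    (H : ∀ y (b : ℝ), h y = b → a + inner ℝ s (y - x) ≤ b) : s ∈ subdiff h x := by
  refine ⟨by simp [hx], fun y => ?_⟩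
  by_cases hy : h y = ⊤
  · simp [hy]
  · obtain ⟨b, hb⟩ := WithTop.ne_top_iff_exists.1 hy
    rw [hx, ← hb]
    exact_mod_cast H y b hb.symm

theorem inner_sub_nonneg_of_mem_subdiff {x y s t : EuclideanSpace ℝ ι} (hs : s ∈ subdiff h x)
    (ht : t ∈ subdiff h y) : 0 ≤ inner ℝ (s - t) (x - y) := by
  obtain ⟨a, ha⟩ := WithTop.ne_top_iff_exists.1 hs.1
  obtain ⟨b, hb⟩ := WithTop.ne_top_iff_exists.1 ht.1
  have h1 := coe_add_inner_le hs ha.symm hb.symm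
  have h2 := coe_add_inner_le ht hb.symm ha.symm
  rw [inner_sub_left]
  rw [← neg_sub, inner_neg_right] at h1
  linarith

theorem le_of_frequently_le_add_mul {a b c : ℝ}
    (H : ∃ᶠ t in nhdsWithin (0 : ℝ) (Set.Ioi 0), a ≤ b + t * c) : a ≤ b := by
  have : Filter.Tendsto (fun t : ℝ => b + t * c) (nhdsWithin 0 (Set.Ioi 0)) (nhds b) := by
    have h1 : Continuous fun t : ℝ => b + t * c := by fun_prop
    have h2 := (h1.tendsto 0).mono_left (nhdsWithin_le_nhds (s := Set.Ioi 0))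
    simpa using h2
  exact ge_of_tendsto_of_frequently this H

theorem eventually_mem_Ioc_zero_one :
    ∀ᶠ t in nhdsWithin (0 : ℝ) (Set.Ioi 0), t ∈ Set.Ioc (0 : ℝ) 1 :=
  Ioc_mem_nhdsGT one_pos

/-- `q` is a quadratic function with gradient `g`, and remainder `C`. -/
structure IsQuadratic {E : Type*} [NormedAddCommGroup E] [InnerProductSpace ℝ E]
    (q : E → ℝ) (g : E → E) (C : E → ℝ) : Prop where
  expand : ∀ x z, q (x + z) = q x + inner ℝ (g x) z + C z
  homog : ∀ (t : ℝ) z, C (t • z) = t ^ 2 * C z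

theorem IsQuadratic.along {E : Type*} [NormedAddCommGroup E] [InnerProductSpace ℝ E]
    {q : E → ℝ} {g : E → E} {C : E → ℝ} (hq : IsQuadratic q g C) (x z : E) (t : ℝ) :
    q (x + t • z) = q x + t * inner ℝ (g x) z + t ^ 2 * C z := by
  rw [hq.expand, hq.homog, inner_smul_right]

/-- Test the subgradient inequality on the segment from `x` to `y`, divide by `t` and let `t → 0`:
the quadratic term disappears, and `s - g x` is normal to the piece. -/
theorem inner_sub_le_zero_of_mem_subdiff {P : Set (EuclideanSpace ℝ ι)}
    {q : EuclideanSpace ℝ ι → ℝ} {g : EuclideanSpace ℝ ι → EuclideanSpace ℝ ι}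
    {C : EuclideanSpace ℝ ι → ℝ} (hP : Convex ℝ P) (hq : IsQuadratic q g C)
    (hhq : ∀ x ∈ P, h x = q x) {x s y : EuclideanSpace ℝ ι} (hs : s ∈ subdiff h x)
    (hx : x ∈ P) (hy : y ∈ P) : inner ℝ (s - g x) (y - x) ≤ 0 := by
  refine le_of_frequently_le_add_mul (c := C (y - x)) (Filter.Eventually.frequently ?_)
  filter_upwards [eventually_mem_Ioc_zero_one] with t ht
  have hmem : x + t • (y - x) ∈ P := hP.add_smul_sub_mem hx hy ⟨ht.1.le, ht.2⟩
  have h1 := coe_add_inner_le hs (hhq x hx) (hhq _ hmem)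
  rw [hq.along, add_sub_cancel_left, inner_smul_right] at h1
  rw [inner_sub_left]
  have h2 : t * (inner ℝ s (y - x) - inner ℝ (g x) (y - x)) ≤ t * (0 + t * C (y - x)) := by
    linarith
  exact le_of_mul_le_mul_left h2 ht.1

/-- The converse: normality on every piece through `x` suffices, because the beginning of any
segment in the domain is seen by one such piece, and convexity turns a bound on the initial slope
into a global one. -/
theorem mem_subdiff_of_forall_inner_le {κ : Type*} [Finite κ]
    {P : κ → Set (EuclideanSpace ℝ ι)} {q : κ → EuclideanSpace ℝ ι → ℝ}
    {g : κ → EuclideanSpace ℝ ι → EuclideanSpace ℝ ι} {C : κ → EuclideanSpace ℝ ι → ℝ}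
    (hh : IsConvexFun h) (hP : ∀ j, IsClosed (P j)) (hdom : {x | h x ≠ ⊤} = ⋃ j, P j)
    (hq : ∀ j, IsQuadratic (q j) (g j) (C j)) (hhq : ∀ j, ∀ x ∈ P j, h x = q j x)
    {x s : EuclideanSpace ℝ ι} (hx : ∃ j, x ∈ P j)
    (H : ∀ j, x ∈ P j → ∀ y ∈ P j, inner ℝ (s - g j x) (y - x) ≤ 0) : s ∈ subdiff h x := by
  obtain ⟨j₀, hj₀⟩ := hx
  refine mem_subdiff_of_real (hhq j₀ x hj₀) fun y b hy => ?_
  -- Finitely many pieces cover the segment, so one of them contains points with arbitrarily small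
  -- `t`; being closed, it also contains `x`.
  obtain ⟨j, hj⟩ : ∃ j, ∃ᶠ t in nhdsWithin (0 : ℝ) (Set.Ioi 0), x + t • (y - x) ∈ P j := by
    by_contra! hcon
    obtain ⟨t, h1, h2⟩ := ((Filter.eventually_all.2 hcon).and eventually_mem_Ioc_zero_one).exists
    have h3 : x + t • (y - x) ∈ {x | h x ≠ ⊤} :=
      ((hh.le_real (hhq j₀ x hj₀) hy h2.1.le h2.2).trans_lt (WithTop.coe_lt_top _)).ne
    rw [hdom] at h3
    obtain ⟨j, hj⟩ := Set.mem_iUnion.1 h3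
    exact h1 j hj
  have hxj : x ∈ P j := by
    have hc : Continuous fun t : ℝ => x + t • (y - x) := by fun_prop
    have h1 := (hc.tendsto 0).mono_left (nhdsWithin_le_nhds (s := Set.Ioi 0))
    simp only [zero_smul, add_zero] at h1
    exact (hP j).mem_of_frequently_of_tendsto hj h1
  have hqx : q j₀ x = q j x := by
    have := (hhq j₀ x hj₀).symm.trans (hhq j x hxj)
    exact_mod_cast this
  rw [hqx]
  refine le_of_frequently_le_add_mul (c := -C j (y - x))
    ((hj.and_eventually eventually_mem_Ioc_zero_one).mono fun t ⟨ht, ht'⟩ => ?_)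
  have h1 := hh.le_real (hhq j x hxj) hy ht'.1.le ht'.2
  rw [hhq j _ ht, WithTop.coe_le_coe, (hq j).along] at h1
  have h2 := H j hxj _ ht
  rw [add_sub_cancel_left, inner_smul_right, inner_sub_left] at h2
  have h3 : t * (q j x + inner ℝ s (y - x)) ≤ t * (b + t * -C j (y - x)) := by linarith
  exact le_of_mul_le_mul_left h3 ht'.1

theorem isQuadratic_toEuclideanLin [DecidableEq ι] (Q : Matrix ι ι ℝ) (c : EuclideanSpace ℝ ι)
    (r : ℝ) : IsQuadratic
      (fun x => 1 / 2 * inner ℝ x (Matrix.toEuclideanLin Q x) + inner ℝ c x + r)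
      (fun x => ((1 / 2 : ℝ) • (Matrix.toEuclideanLin Q +
        LinearMap.adjoint (Matrix.toEuclideanLin Q))) x + c)
      (fun z => 1 / 2 * inner ℝ z (Matrix.toEuclideanLin Q z)) where
  expand x z := by
    simp only [LinearMap.smul_apply, LinearMap.add_apply, map_add, inner_add_left,
      inner_add_right, inner_smul_left, LinearMap.adjoint_inner_left,
      real_inner_comm z (Matrix.toEuclideanLin Q x), RCLike.conj_to_real]
    ring
  homog t z := by
    simp only [map_smul, inner_smul_left, inner_smul_right, RCLike.conj_to_real]
    ring

/-- Otherwise Farkas' lemma gives a direction that no active constraint forbids and along which `v`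
increases; a short step in it stays in the polyhedron. -/
theorem polar_subset_hull {κ : Type*} [Finite κ] {a : κ → EuclideanSpace ℝ ι} {b : κ → ℝ}
    {x v : EuclideanSpace ℝ ι} (hx : ∀ i, inner ℝ (a i) x ≤ b i)
    (hv : ∀ y, (∀ i, inner ℝ (a i) y ≤ b i) → inner ℝ v (y - x) ≤ 0) :
    v ∈ PointedCone.hull ℝ (a '' {i | inner ℝ (a i) x = b i}) := by
  by_contra hcon
  obtain ⟨c, hc, hcv⟩ := exists_functional_of_notMem_hull (Set.toFinite _) hcon
  let z := (InnerProductSpace.toDual ℝ (EuclideanSpace ℝ ι)).symm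
    (LinearMap.toContinuousLinearMap c)
  have hz : ∀ y, c y = inner ℝ y z := fun y => by
    rw [real_inner_comm, InnerProductSpace.toDual_symm_apply]; rfl
  have hev : ∀ᶠ t in nhdsWithin (0 : ℝ) (Set.Ioi 0), ∀ i,
      inner ℝ (a i) (x + t • z) ≤ b i := by
    refine Filter.eventually_all.2 fun i => ?_
    rcases (hx i).eq_or_lt with hi | hi
    · filter_upwards [eventually_mem_Ioc_zero_one] with t ht
      have := hc _ ⟨i, hi, rfl⟩
      rw [hz] at this
      rw [inner_add_right, inner_smul_right, hi]
      nlinarith [ht.1]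
    · have hcont : Continuous fun t : ℝ => inner ℝ (a i) (x + t • z) := by fun_prop
      have h1 := (hcont.tendsto 0).mono_left (nhdsWithin_le_nhds (s := Set.Ioi 0))
      simp only [zero_smul, add_zero] at h1
      exact (h1.eventually_lt_const hi).mono fun t ht => ht.le
  obtain ⟨t, ht, ht'⟩ := (hev.and eventually_mem_Ioc_zero_one).exists
  have h1 := hv _ ht
  rw [add_sub_cancel_left, inner_smul_right, ← hz] at h1
  nlinarith [ht'.1]

theorem inner_le_zero_of_mem_hull {κ : Type*} {a : κ → EuclideanSpace ℝ ι} {b : κ → ℝ}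
    {x v : EuclideanSpace ℝ ι}
    (hv : v ∈ PointedCone.hull ℝ (a '' {i | inner ℝ (a i) x = b i}))
    {y : EuclideanSpace ℝ ι} (hy : ∀ i, inner ℝ (a i) y ≤ b i) : inner ℝ v (y - x) ≤ 0 := by
  induction hv using Submodule.span_induction with
  | mem v hv =>
    obtain ⟨i, hi, rfl⟩ := hv
    rw [inner_sub_right, sub_nonpos]
    exact (hy i).trans_eq (Eq.symm hi)
  | zero => simp
  | add v w _ _ hv hw => rw [inner_add_left]; linarith
  | smul t v _ hv =>
    change inner ℝ ((t : ℝ) • v) (y - x) ≤ 0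
    rw [real_inner_smul_left]
    exact mul_nonpos_of_nonneg_of_nonpos t.2 hv

end Subdiff

/-! ### The subdifferential graph over a hyperplane arrangement -/

section PLQ

variable {ι : Type*} [Fintype ι] {h : EuclideanSpace ℝ ι → WithTop ℝ}

/-- The position of `x` relative to the hyperplanes that bound a family of polyhedra. -/
noncomputable def hyperplaneSign {N : ℕ} {m : Fin N → ℕ}
    (a : ∀ j, Fin (m j) → EuclideanSpace ℝ ι) (b : ∀ j, Fin (m j) → ℝ) (x : EuclideanSpace ℝ ι)
    (k : Σ j, Fin (m j)) : SignType :=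
  SignType.sign (inner ℝ (a k.1 k.2) x - b k.1 k.2)

/-- The part of the graph of the subdifferential of a piecewise linear-quadratic function over the
closed cell of the hyperplane arrangement with sign vector `σ`. -/
def subdiffPiece {N : ℕ} {m : Fin N → ℕ}
    (a : ∀ j, Fin (m j) → EuclideanSpace ℝ ι) (b : ∀ j, Fin (m j) → ℝ)
    (g : Fin N → EuclideanSpace ℝ ι → EuclideanSpace ℝ ι) (σ : (Σ j, Fin (m j)) → SignType) :
    Set (EuclideanSpace ℝ ι × EuclideanSpace ℝ ι) :=
  {p | (∀ k, (0 ≤ σ k → b k.1 k.2 ≤ inner ℝ (a k.1 k.2) p.1) ∧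
      (σ k ≤ 0 → inner ℝ (a k.1 k.2) p.1 ≤ b k.1 k.2)) ∧
    ∀ j, (∀ i, σ ⟨j, i⟩ ≤ 0) →
      p.2 - g j p.1 ∈ PointedCone.hull ℝ (a j '' {i | σ ⟨j, i⟩ = 0})}

variable {N : ℕ} {m : Fin N → ℕ} {a : ∀ j, Fin (m j) → EuclideanSpace ℝ ι}
  {b : ∀ j, Fin (m j) → ℝ}

/-- The sign vector, not the point, selects the pieces and the active normals. Each cone is thus
fixed, and Weyl's theorem makes it polyhedral. -/
theorem isPolyhedron_subdiffPiece (L : Fin N → EuclideanSpace ℝ ι →ₗ[ℝ] EuclideanSpace ℝ ι)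
    (c : Fin N → EuclideanSpace ℝ ι) (σ : (Σ j, Fin (m j)) → SignType) :
    IsPolyhedron (subdiffPiece a b (fun j x => L j x + c j) σ) := by
  let E := EuclideanSpace ℝ ι
  have h1 : ∀ k : Σ j, Fin (m j),
      IsPolyhedron {p : E × E | 0 ≤ σ k → b k.1 k.2 ≤ inner ℝ (a k.1 k.2) p.1} := fun k =>
    ((isPolyhedron_halfspace (-((innerₗ _ (a k.1 k.2)).comp (LinearMap.fst ℝ E E)))
      (-b k.1 k.2)).imp (0 ≤ σ k)).congr fun p => forall_congr' fun _ =>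
      neg_le_neg_iff (a := inner ℝ (a k.1 k.2) p.1) (b := b k.1 k.2)
  have h2 : ∀ k : Σ j, Fin (m j),
      IsPolyhedron {p : E × E | σ k ≤ 0 → inner ℝ (a k.1 k.2) p.1 ≤ b k.1 k.2} := fun k =>
    (isPolyhedron_halfspace ((innerₗ _ (a k.1 k.2)).comp (LinearMap.fst ℝ E E))
      (b k.1 k.2)).imp (σ k ≤ 0)
  have h3 : ∀ j, IsPolyhedron {p : E × E | (∀ i, σ ⟨j, i⟩ ≤ 0) →
      p.2 - (L j p.1 + c j) ∈ PointedCone.hull ℝ (a j '' {i | σ ⟨j, i⟩ = 0})} := fun j => by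
    refine (((isPolyhedron_hull (Set.toFinite (a j '' {i | σ ⟨j, i⟩ = 0}))).preimage
      (LinearMap.snd ℝ E E - (L j).comp (LinearMap.fst ℝ E E)) (-c j)).imp
      (∀ i, σ ⟨j, i⟩ ≤ 0)).congr fun p => forall_congr' fun _ => ?_
    change p.2 - L j p.1 + -c j ∈ PointedCone.hull ℝ _ ↔ _
    rw [sub_add_eq_sub_sub, sub_eq_add_neg (p.2 - L j p.1)]
  exact ((IsPolyhedron.forall fun k => (h1 k).inter (h2 k)).inter
    (IsPolyhedron.forall h3)).congr fun p => Iff.rfl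

theorem hyperplaneSign_nonpos {x : EuclideanSpace ℝ ι} {k : Σ j, Fin (m j)} :
    hyperplaneSign a b x k ≤ 0 ↔ inner ℝ (a k.1 k.2) x ≤ b k.1 k.2 := by
  rw [hyperplaneSign, sign_nonpos_iff, sub_nonpos]

theorem hyperplaneSign_nonneg {x : EuclideanSpace ℝ ι} {k : Σ j, Fin (m j)} :
    0 ≤ hyperplaneSign a b x k ↔ b k.1 k.2 ≤ inner ℝ (a k.1 k.2) x := by
  rw [hyperplaneSign, sign_nonneg_iff, sub_nonneg]

theorem hyperplaneSign_eq_zero {x : EuclideanSpace ℝ ι} {k : Σ j, Fin (m j)} :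
    hyperplaneSign a b x k = 0 ↔ inner ℝ (a k.1 k.2) x = b k.1 k.2 := by
  rw [hyperplaneSign, sign_eq_zero_iff, sub_eq_zero]

/-- The open segment from a point of a closed cell to a point of the relatively open cell stays in
the relatively open cell. -/
theorem hyperplaneSign_segment {x x₀ : EuclideanSpace ℝ ι}
    (hx : ∀ k : Σ j, Fin (m j),
      (0 ≤ hyperplaneSign a b x₀ k → b k.1 k.2 ≤ inner ℝ (a k.1 k.2) x) ∧
      (hyperplaneSign a b x₀ k ≤ 0 → inner ℝ (a k.1 k.2) x ≤ b k.1 k.2))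
    {t : ℝ} (ht : t ∈ Set.Ioc (0 : ℝ) 1) :
    hyperplaneSign a b (x + t • (x₀ - x)) = hyperplaneSign a b x₀ := by
  funext k
  obtain ⟨h1, h2⟩ := hx k
  have he : inner ℝ (a k.1 k.2) (x + t • (x₀ - x)) - b k.1 k.2 =
      (1 - t) * (inner ℝ (a k.1 k.2) x - b k.1 k.2) +
        t * (inner ℝ (a k.1 k.2) x₀ - b k.1 k.2) := by
    simp only [inner_add_right, inner_smul_right, inner_sub_right]
    ring
  have ht1 : 0 ≤ 1 - t := sub_nonneg.2 ht.2
  rw [hyperplaneSign_nonneg] at h1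
  rw [hyperplaneSign_nonpos] at h2
  unfold hyperplaneSign
  rw [he]
  rcases lt_trichotomy (inner ℝ (a k.1 k.2) x₀ - b k.1 k.2) 0 with h0 | h0 | h0
  · rw [sign_neg h0, sign_neg]
    have := mul_nonpos_of_nonneg_of_nonpos ht1 (sub_nonpos.2 (h2 (sub_neg.1 h0).le))
    have := mul_neg_of_pos_of_neg ht.1 h0
    linarith
  · have := sub_eq_zero.1 h0
    rw [h0, le_antisymm (h2 this.le) (h1 this.ge)]
    simp
  · rw [sign_pos h0, sign_pos]
    have := mul_nonneg ht1 (sub_nonneg.2 (h1 (sub_pos.1 h0).le))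
    have := mul_pos ht.1 h0
    linarith

variable {q : Fin N → EuclideanSpace ℝ ι → ℝ} {C : Fin N → EuclideanSpace ℝ ι → ℝ}

theorem convex_setOf_forall_inner_le {κ : Type*} (a : κ → EuclideanSpace ℝ ι) (b : κ → ℝ) :
    Convex ℝ {x | ∀ i, inner ℝ (a i) x ≤ b i} := by
  rw [Set.ofPred_forall]
  exact convex_iInter fun i => convex_halfSpace_le (innerₗ _ (a i)).isLinear _

theorem isClosed_setOf_forall_inner_le {κ : Type*} (a : κ → EuclideanSpace ℝ ι) (b : κ → ℝ) :
    IsClosed {x | ∀ i, inner ℝ (a i) x ≤ b i} := by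
  rw [Set.ofPred_forall]
  exact isClosed_iInter fun i => isClosed_le (by fun_prop) continuous_const

theorem mem_subdiffPiece_of_mem_subdiff
    {g : Fin N → EuclideanSpace ℝ ι → EuclideanSpace ℝ ι}
    (hq : ∀ j, IsQuadratic (q j) (g j) (C j))
    (hhq : ∀ j x, (∀ i, inner ℝ (a j i) x ≤ b j i) → h x = q j x)
    {x s : EuclideanSpace ℝ ι} (hs : s ∈ subdiff h x) :
    (x, s) ∈ subdiffPiece a b g (hyperplaneSign a b x) := by
  refine ⟨fun k => ⟨hyperplaneSign_nonneg.1, hyperplaneSign_nonpos.1⟩, fun j hj => ?_⟩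
  have hx : ∀ i, inner ℝ (a j i) x ≤ b j i := fun i => hyperplaneSign_nonpos.1 (hj i)
  have := polar_subset_hull hx fun y hy => inner_sub_le_zero_of_mem_subdiff
    (convex_setOf_forall_inner_le (a j) (b j)) (hq j) (hhq j) hs hx hy
  simpa only [hyperplaneSign_eq_zero] using this

theorem mem_subdiff_of_mem_subdiffPiece
    {g : Fin N → EuclideanSpace ℝ ι → EuclideanSpace ℝ ι} (hh : IsConvexFun h)
    (hdom : {x | h x ≠ ⊤} = ⋃ j, {x | ∀ i, inner ℝ (a j i) x ≤ b j i})
    (hq : ∀ j, IsQuadratic (q j) (g j) (C j))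
    (hhq : ∀ j x, (∀ i, inner ℝ (a j i) x ≤ b j i) → h x = q j x)
    {x s : EuclideanSpace ℝ ι} (hx : ∃ j, ∀ i, hyperplaneSign a b x ⟨j, i⟩ ≤ 0)
    (hs : (x, s) ∈ subdiffPiece a b g (hyperplaneSign a b x)) : s ∈ subdiff h x := by
  refine mem_subdiff_of_forall_inner_le hh
    (fun j => isClosed_setOf_forall_inner_le (a j) (b j)) hdom hq hhq
    (hx.imp fun j hj i => hyperplaneSign_nonpos.1 (hj i)) fun j hj y hy => ?_
  refine inner_le_zero_of_mem_hull (a := a j) (b := b j) ?_ hy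
  have := hs.2 j fun i => hyperplaneSign_nonpos.2 (hj i)
  simpa only [hyperplaneSign_eq_zero] using this

/-- The graph of the subdifferential of a convex piecewise linear-quadratic function is a finite
union of polyhedra. -/
theorem IsPLQ.isPolyUnion_subdiff {ι : Type} [Fintype ι] [DecidableEq ι]
    {h : EuclideanSpace ℝ ι → WithTop ℝ} (hplq : IsPLQ h) (hh : IsConvexFun h) :
    IsPolyUnion {p : EuclideanSpace ℝ ι × EuclideanSpace ℝ ι | p.2 ∈ subdiff h p.1} := by
  obtain ⟨N, P, hP, hdom, hq⟩ := hplq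
  choose m a b hab using hP
  choose Q c r hhq using hq
  obtain rfl : P = fun j => {x | ∀ i, inner ℝ (a j i) x ≤ b j i} := funext hab
  have hquad := fun j => isQuadratic_toEuclideanLin (Q j) (c j) (r j)
  set L : Fin N → EuclideanSpace ℝ ι →ₗ[ℝ] EuclideanSpace ℝ ι := fun j =>
    (1 / 2 : ℝ) • (Matrix.toEuclideanLin (Q j) + LinearMap.adjoint (Matrix.toEuclideanLin (Q j)))
  -- Only sign vectors realized at a point with a subgradient are kept: over a cell outside the
  -- domain the conditions on `s` would be void.
  refine ⟨{σ : (Σ j, Fin (m j)) → SignType //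
    ∃ x s, s ∈ subdiff h x ∧ hyperplaneSign a b x = σ}, inferInstance,
    fun σ => subdiffPiece a b (fun j x => L j x + c j) σ.1,
    fun σ => isPolyhedron_subdiffPiece L c σ.1, ?_⟩
  ext ⟨x, s⟩
  simp only [Set.mem_iUnion, Subtype.exists]
  constructor
  · intro hs
    exact ⟨_, ⟨x, s, hs, rfl⟩, mem_subdiffPiece_of_mem_subdiff hquad hhq hs⟩
  · rintro ⟨_, ⟨x₀, s₀, hs₀, rfl⟩, hxs⟩
    have h₀ := mem_subdiffPiece_of_mem_subdiff hquad hhq hs₀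
    obtain ⟨j, hj⟩ : ∃ j, ∀ i, hyperplaneSign a b x₀ ⟨j, i⟩ ≤ 0 := by
      have : x₀ ∈ {x | h x ≠ ⊤} := hs₀.1
      rw [hdom] at this
      exact (Set.mem_iUnion.1 this).imp fun j hj i => hyperplaneSign_nonpos.2 (hj i)
    -- At a boundary point of the cell the active set may grow, so membership is not tested at `x`
    -- directly. The segment towards `(x₀, s₀)` has constant signs for `t > 0`, lies in the graph,
    -- and `t → 0` gives the subgradient inequality at `x`.
    have hseg : ∀ t ∈ Set.Ioc (0 : ℝ) 1, s + t • (s₀ - s) ∈ subdiff h (x + t • (x₀ - x)) := by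
      intro t ht
      have hsign := hyperplaneSign_segment hxs.1 ht
      refine mem_subdiff_of_mem_subdiffPiece hh hdom hquad hhq (by rw [hsign]; exact ⟨j, hj⟩) ?_
      rw [hsign]
      have hconv : Convex ℝ (subdiffPiece a b (fun j x => L j x + c j)
          (hyperplaneSign a b x₀)) := by
        obtain ⟨κ, _, A, B, hAB⟩ :=
          isPolyhedron_subdiffPiece (a := a) (b := b) L c (hyperplaneSign a b x₀)
        rw [hAB, Set.ofPred_forall]
        exact convex_iInter fun i => convex_halfSpace_le (A i).isLinear _
      exact hconv.add_smul_sub_mem hxs h₀ ⟨ht.1.le, ht.2⟩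
    have hxj : ∀ i, inner ℝ (a j i) x ≤ b j i := fun i => (hxs.1 ⟨j, i⟩).2 (hj i)
    refine mem_subdiff_of_real (hhq j x hxj) fun y d hy => ?_
    have hlim : ∀ t ∈ Set.Ioc (0 : ℝ) 1,
        1 / 2 * inner ℝ (x + t • (x₀ - x)) (Matrix.toEuclideanLin (Q j) (x + t • (x₀ - x))) +
          inner ℝ (c j) (x + t • (x₀ - x)) + r j +
          inner ℝ (s + t • (s₀ - s)) (y - (x + t • (x₀ - x))) ≤ d := fun t ht => by
      refine coe_add_inner_le (hseg t ht) (hhq j _ ?_) hy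
      intro i
      have := hj i
      rw [← hyperplaneSign_segment hxs.1 ht] at this
      exact hyperplaneSign_nonpos.1 this
    have hcont : Continuous fun t : ℝ =>
        1 / 2 * inner ℝ (x + t • (x₀ - x)) (Matrix.toEuclideanLin (Q j) (x + t • (x₀ - x))) +
          inner ℝ (c j) (x + t • (x₀ - x)) + r j +
          inner ℝ (s + t • (s₀ - s)) (y - (x + t • (x₀ - x))) := by
      have := LinearMap.continuous_of_finiteDimensional (Matrix.toEuclideanLin (Q j))
      fun_prop
    have h1 := (hcont.tendsto 0).mono_left (nhdsWithin_le_nhds (s := Set.Ioi 0))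
    simp only [zero_smul, add_zero] at h1
    exact le_of_tendsto h1 (eventually_mem_Ioc_zero_one.mono hlim)

end PLQ

/-! ### Polyhedral models of monotone graphs -/

/-- Near `p`, the graph `D` is approximated by a finite union of polyhedra contained in `D`, up to
an error that is controlled by the monotonicity of `D`. -/
def HasPolyhedralModel {E : Type*} [NormedAddCommGroup E] [InnerProductSpace ℝ E]
    (D : Set (E × E)) (p : E × E) : Prop :=
  ∃ S : Set (E × E), IsPolyUnion S ∧ S ⊆ D ∧ p ∈ S ∧ ∃ L : ℝ, 0 ≤ L ∧ ∃ ε : ℝ, 0 < ε ∧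
    ∀ q ∈ D, ‖q - p‖ < ε → ∃ q' ∈ S, ∃ ρ : ℝ, 0 ≤ ρ ∧ ‖q - q'‖ ≤ L * ρ ∧
      ∀ r ∈ S, ρ ^ 2 ≤ inner ℝ (q.2 - r.2) (q.1 - r.1)

theorem IsPLQ.hasPolyhedralModel {ι : Type} [Fintype ι] [DecidableEq ι]
    {h : EuclideanSpace ℝ ι → WithTop ℝ} (hplq : IsPLQ h) (hh : IsConvexFun h)
    {p : EuclideanSpace ℝ ι × EuclideanSpace ℝ ι} (hp : p.2 ∈ subdiff h p.1) :
    HasPolyhedralModel {p | p.2 ∈ subdiff h p.1} p :=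
  ⟨_, hplq.isPolyUnion_subdiff hh, subset_rfl, hp, 0, le_rfl, 1, one_pos, fun q hq _ =>
    ⟨q, hq, 0, le_rfl, by simp, fun r hr => by
      simpa using inner_sub_nonneg_of_mem_subdiff hq hr⟩⟩

theorem eq_gradient_of_mem_subdiff {ι : Type*} [Fintype ι] {h : EuclideanSpace ℝ ι → WithTop ℝ}
    {φ : EuclideanSpace ℝ ι → ℝ} (hφ : ∀ x, h x = φ x) {x s : EuclideanSpace ℝ ι}
    (hd : DifferentiableAt ℝ φ x) (hs : s ∈ subdiff h x) : s = gradient φ x := by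
  have h1 : HasFDerivAt (fun y => φ y - inner ℝ s y)
      (InnerProductSpace.toDual ℝ _ (gradient φ x) - innerSL ℝ s) x :=
    hd.hasGradientAt.hasFDerivAt.sub (innerSL ℝ s).hasFDerivAt
  have h2 : IsLocalMin (fun y => φ y - inner ℝ s y) x :=
    Filter.Eventually.of_forall fun y => by
      have := coe_add_inner_le hs (hφ x) (hφ y)
      rw [inner_sub_right] at this
      dsimp only
      linarith
  have h3 := h2.hasFDerivAt_eq_zero h1
  refine ext_inner_right ℝ fun v => ?_
  have h4 := congrArg (fun T => T v) h3
  simp only [sub_apply, InnerProductSpace.toDual_apply_apply,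
    innerSL_apply_apply, zero_apply] at h4
  linarith

/-- Add the two subgradient inequalities at the midpoint of `x` and `y` to strong convexity there.
The midpoint yields `m / 2` instead of the sharp `m`, which is enough. -/
theorem StrongConvexOn.inner_sub_ge_of_mem_subdiff {ι : Type*} [Fintype ι]
    {h : EuclideanSpace ℝ ι → WithTop ℝ} {φ : EuclideanSpace ℝ ι → ℝ} {m : ℝ}
    (hm : StrongConvexOn Set.univ m φ) (hφ : ∀ x, h x = φ x) {x y s t : EuclideanSpace ℝ ι}
    (hs : s ∈ subdiff h x) (ht : t ∈ subdiff h y) :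
    m / 2 * ‖x - y‖ ^ 2 ≤ inner ℝ (s - t) (x - y) := by
  obtain ⟨-, hm⟩ := hm
  have h1 := hm (Set.mem_univ x) (Set.mem_univ y) (a := 1 / 2) (b := 1 / 2)
    (by norm_num) (by norm_num) (by norm_num)
  have h2 := coe_add_inner_le hs (hφ x) (hφ ((1 / 2 : ℝ) • x + (1 / 2 : ℝ) • y))
  have h3 := coe_add_inner_le ht (hφ y) (hφ ((1 / 2 : ℝ) • x + (1 / 2 : ℝ) • y))
  have e2 : (1 / 2 : ℝ) • x + (1 / 2 : ℝ) • y - x = -((1 / 2 : ℝ) • (x - y)) := by module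
  have e3 : (1 / 2 : ℝ) • x + (1 / 2 : ℝ) • y - y = (1 / 2 : ℝ) • (x - y) := by module
  rw [e2, inner_neg_right, inner_smul_right] at h2
  rw [e3, inner_smul_right] at h3
  simp only [smul_eq_mul] at h1
  rw [inner_sub_left]
  linarith

/-- The model is the single point `p`. Strong monotonicity gives `ρ = √(m / 2) * ‖q.1 - p.1‖`, and
the local Lipschitz constant of the gradient bounds `‖q - p‖` by a multiple of `ρ`. -/
theorem IsSmoothStronglyConvex.hasPolyhedralModel {ι : Type} [Fintype ι]
    {h : EuclideanSpace ℝ ι → WithTop ℝ} (hsm : IsSmoothStronglyConvex h)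
    {p : EuclideanSpace ℝ ι × EuclideanSpace ℝ ι} (hp : p.2 ∈ subdiff h p.1) :
    HasPolyhedralModel {p | p.2 ∈ subdiff h p.1} p := by
  obtain ⟨φ, hφ, hd, hlip, m, hm, hsc⟩ := hsm
  obtain ⟨K, t, ht, hK⟩ := hlip p.1
  obtain ⟨ε, hε, hball⟩ := Metric.mem_nhds_iff.1 ht
  have hm2 : 0 < √(m / 2) := Real.sqrt_pos.2 (by positivity)
  refine ⟨{p}, (isPolyhedron_singleton p).isPolyUnion, by simpa using hp, rfl,
    max 1 (K : ℝ) / √(m / 2), by positivity, ε, hε, fun q hq hqε => ⟨p, rfl,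
    √(m / 2) * ‖q.1 - p.1‖, by positivity, ?_, ?_⟩⟩
  · rw [← mul_assoc, div_mul_cancel₀ _ hm2.ne', max_mul_of_nonneg _ _ (norm_nonneg _), one_mul]
    refine max_le_max le_rfl ?_
    change ‖q.2 - p.2‖ ≤ _
    rw [eq_gradient_of_mem_subdiff hφ (hd _) hq, eq_gradient_of_mem_subdiff hφ (hd _) hp,
      ← dist_eq_norm, ← dist_eq_norm]
    refine hK.dist_le_mul _ (hball ?_) _ (mem_of_mem_nhds ht)
    rw [Metric.mem_ball, dist_eq_norm]
    exact (norm_fst_le (q - p)).trans_lt hqε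
  · rintro r rfl
    rw [mul_pow, Real.sq_sqrt (by positivity)]
    exact hsc.inner_sub_ge_of_mem_subdiff hφ hq hp

/-! ### Separable sums -/

section Separable

variable {n d : ℕ}

/-- The local variable of agent `i` as a linear map. -/
def localVarLin (n d : ℕ) (i : Fin n) : StackSpace n d →ₗ[ℝ] EuclideanSpace ℝ (Fin d) where
  toFun u := localVar u i
  map_add' _ _ := rfl
  map_smul' _ _ := rfl

/-- The stacked variable with given local variables. -/
def stackVar (x : Fin n → EuclideanSpace ℝ (Fin d)) : StackSpace n d :=
  WithLp.toLp 2 fun p => x p.1 p.2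

theorem localVar_stackVar (x : Fin n → EuclideanSpace ℝ (Fin d)) (i : Fin n) :
    localVar (stackVar x) i = x i := rfl

theorem localVar_sub (u v : StackSpace n d) (i : Fin n) :
    localVar (u - v) i = localVar u i - localVar v i := rfl

theorem inner_eq_sum_localVar (u v : StackSpace n d) :
    inner ℝ u v = ∑ i, inner ℝ (localVar u i) (localVar v i) := by
  simp only [PiLp.inner_apply]
  exact Fintype.sum_prod_type _

theorem norm_localVar_le (u : StackSpace n d) (i : Fin n) : ‖localVar u i‖ ≤ ‖u‖ := by
  rw [← sq_le_sq₀ (norm_nonneg _) (norm_nonneg _), ← real_inner_self_eq_norm_sq,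
    ← real_inner_self_eq_norm_sq, inner_eq_sum_localVar]
  exact Finset.single_le_sum (f := fun i => inner ℝ (localVar u i) (localVar u i))
    (fun _ _ => real_inner_self_nonneg) (Finset.mem_univ i)

theorem norm_le_sum_localVar (u : StackSpace n d) : ‖u‖ ≤ ∑ i, ‖localVar u i‖ := by
  rw [← sq_le_sq₀ (norm_nonneg _) (Finset.sum_nonneg fun _ _ => norm_nonneg _),
    ← real_inner_self_eq_norm_sq, inner_eq_sum_localVar]
  simp only [real_inner_self_eq_norm_sq]
  exact Finset.sum_sq_le_sq_sum_of_nonneg fun _ _ => norm_nonneg _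

theorem separableSum_eq_coe {f : Fin n → EuclideanSpace ℝ (Fin d) → WithTop ℝ}
    {u : StackSpace n d} {a : Fin n → ℝ} (h : ∀ i, f i (localVar u i) = a i) :
    separableSum f u = ((∑ i, a i : ℝ) : WithTop ℝ) := by
  simp only [separableSum, h, WithTop.coe_sum]

theorem mem_subdiff_separableSum {f : Fin n → EuclideanSpace ℝ (Fin d) → WithTop ℝ}
    {u s : StackSpace n d} : s ∈ subdiff (separableSum f) u ↔
      ∀ i, localVar s i ∈ subdiff (f i) (localVar u i) := by
  constructor
  · intro hs i
    have hfin : ∀ i, f i (localVar u i) ≠ ⊤ := fun i hi =>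
      hs.1 (WithTop.sum_eq_top.2 ⟨i, Finset.mem_univ i, hi⟩)
    choose a ha using fun i => WithTop.ne_top_iff_exists.1 (hfin i)
    refine mem_subdiff_of_real (ha i).symm fun y b hy => ?_
    -- Vary only block `i`; all other terms cancel.
    let x : Fin n → EuclideanSpace ℝ (Fin d) := Function.update (fun j => localVar u j) i y
    have h1 : ∀ j, f j (localVar (stackVar x) j) = (Function.update a i b j : ℝ) := fun j => by
      rw [localVar_stackVar]
      by_cases hj : j = i
      · subst hj; simpa [x] using hy
      · simpa [x, hj] using (ha j).symm
    have h2 := coe_add_inner_le hs (separableSum_eq_coe fun j => (ha j).symm)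
      (separableSum_eq_coe h1)
    have h3 : inner ℝ s (stackVar x - u) = inner ℝ (localVar s i) (y - localVar u i) := by
      rw [inner_eq_sum_localVar, Finset.sum_eq_single i]
      · simp [localVar_sub, localVar_stackVar, x]
      · intro j _ hj
        simp [localVar_sub, localVar_stackVar, x, hj]
      · simp
    rw [h3, Finset.sum_update_of_mem (Finset.mem_univ i),
      ← Finset.add_sum_erase _ _ (Finset.mem_univ i), Finset.erase_eq] at h2
    linarith
  · intro hs
    choose a ha using fun i => WithTop.ne_top_iff_exists.1 (hs i).1
    refine mem_subdiff_of_real (separableSum_eq_coe fun i => (ha i).symm) fun y b hy => ?_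
    have hfin : ∀ i, f i (localVar y i) ≠ ⊤ := fun i hi => by
      have : separableSum f y = ⊤ := WithTop.sum_eq_top.2 ⟨i, Finset.mem_univ i, hi⟩
      simp [this] at hy
    choose c hc using fun i => WithTop.ne_top_iff_exists.1 (hfin i)
    rw [separableSum_eq_coe fun i => (hc i).symm, WithTop.coe_inj] at hy
    rw [← hy, inner_eq_sum_localVar, ← Finset.sum_add_distrib]
    exact Finset.sum_le_sum fun i _ => coe_add_inner_le (hs i) (ha i).symm (hc i).symm

/-- The pairing of a stacked graph is the sum of the local pairings, so the local `ρ i` combine to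
`√(∑ i, ρ i ^ 2)`. -/
theorem hasPolyhedralModel_separableSum {f : Fin n → EuclideanSpace ℝ (Fin d) → WithTop ℝ}
    {p : StackSpace n d × StackSpace n d}
    (h : ∀ i, HasPolyhedralModel {q | q.2 ∈ subdiff (f i) q.1}
      (localVar p.1 i, localVar p.2 i)) :
    HasPolyhedralModel {q | q.2 ∈ subdiff (separableSum f) q.1} p := by
  choose S hS hSD hpS L hL ε hε H using h
  obtain ⟨δ, hδ, hδε⟩ := Metric.eventually_nhds_iff.1 (Filter.eventually_all.2 fun i =>
    (eventually_lt_nhds (hε i)))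
  refine ⟨⋂ i, ((localVarLin n d i).prodMap (localVarLin n d i)) ⁻¹' S i,
    IsPolyUnion.iInter fun i => (hS i).preimage _, fun q hq => mem_subdiff_separableSum.2
    fun i => hSD i (Set.mem_iInter.1 hq i), Set.mem_iInter.2 hpS, ∑ i, L i,
    Finset.sum_nonneg fun i _ => hL i, δ / 2, by positivity, fun q hq hqp => ?_⟩
  have h1 : ∀ i, ∃ q' ∈ S i, ∃ ρ : ℝ, 0 ≤ ρ ∧
      ‖(localVar q.1 i, localVar q.2 i) - q'‖ ≤ L i * ρ ∧
      ∀ r ∈ S i, ρ ^ 2 ≤ inner ℝ (localVar q.2 i - r.2) (localVar q.1 i - r.1) := fun i => by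
    refine H i _ (mem_subdiff_separableSum.1 hq i) (lt_of_le_of_lt ?_
      (hδε (y := δ / 2) (by rw [Real.dist_eq, sub_zero, abs_of_pos] <;> linarith) i))
    refine le_trans ?_ hqp.le
    exact max_le_max (norm_localVar_le (q.1 - p.1) i) (norm_localVar_le (q.2 - p.2) i)
  choose q' hq' ρ hρ hqq' hmono using h1
  have hρle : ∀ i, ρ i ≤ √(∑ i, ρ i ^ 2) := fun i => Real.le_sqrt_of_sq_le
    (Finset.single_le_sum (f := fun i => ρ i ^ 2) (fun _ _ => sq_nonneg _) (Finset.mem_univ i))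
  have hqq'' : ∀ i, ‖(localVar q.1 i, localVar q.2 i) - q' i‖ ≤ L i * √(∑ i, ρ i ^ 2) :=
    fun i => (hqq' i).trans (mul_le_mul_of_nonneg_left (hρle i) (hL i))
  refine ⟨(stackVar fun i => (q' i).1, stackVar fun i => (q' i).2), Set.mem_iInter.2 hq',
    √(∑ i, ρ i ^ 2), Real.sqrt_nonneg _, ?_, fun r hr => ?_⟩
  · rw [Finset.sum_mul]
    refine max_le ((norm_le_sum_localVar _).trans (Finset.sum_le_sum fun i _ => ?_))
      ((norm_le_sum_localVar _).trans (Finset.sum_le_sum fun i _ => ?_))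
    · exact (norm_fst_le ((localVar q.1 i, localVar q.2 i) - q' i)).trans (hqq'' i)
    · exact (norm_snd_le ((localVar q.1 i, localVar q.2 i) - q' i)).trans (hqq'' i)
  · rw [Real.sq_sqrt (Finset.sum_nonneg fun _ _ => sq_nonneg _), inner_eq_sum_localVar]
    exact Finset.sum_le_sum fun i _ => hmono i _ (Set.mem_iInter.1 hr i)

end Separable

/-! ### The error bound for the optimality system -/

section Saddle

variable {E F Y : Type*} [NormedAddCommGroup E] [InnerProductSpace ℝ E]
  [NormedAddCommGroup F] [InnerProductSpace ℝ F] [NormedAddCommGroup Y] [InnerProductSpace ℝ Y]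

/-- The residual `(s - Aᵀ λ, t + Bᵀ λ, A u - B v)` of the optimality system at
`((u, s), (v, t), λ)`. -/
noncomputable def kktResidual (A : E →L[ℝ] Y) (At : Y →L[ℝ] E) (B : F →L[ℝ] Y)
    (Bt : Y →L[ℝ] F) : (E × E) × (F × F) × Y →L[ℝ] E × F × Y :=
  let p := ContinuousLinearMap.fst ℝ (E × E) ((F × F) × Y)
  let r := ContinuousLinearMap.snd ℝ (E × E) ((F × F) × Y)
  let q := (ContinuousLinearMap.fst ℝ (F × F) Y).comp r
  let l := (ContinuousLinearMap.snd ℝ (F × F) Y).comp r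
  ((ContinuousLinearMap.snd ℝ E E).comp p - At.comp l).prod
    (((ContinuousLinearMap.snd ℝ F F).comp q + Bt.comp l).prod
      (A.comp ((ContinuousLinearMap.fst ℝ E E).comp p) -
        B.comp ((ContinuousLinearMap.fst ℝ F F).comp q)))

theorem kktResidual_apply (A : E →L[ℝ] Y) (At : Y →L[ℝ] E) (B : F →L[ℝ] Y)
    (Bt : Y →L[ℝ] F) (z : (E × E) × (F × F) × Y) : kktResidual A At B Bt z =
      (z.1.2 - At z.2.2, z.2.1.2 + Bt z.2.2, A z.1.1 - B z.2.1.1) := rfl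

/-- The positive root of `ρ ^ 2 = a * η * (η + ρ)` is at most `(a + 1) * η`; this absorbs `ρ` into
the residual. -/
theorem le_mul_of_sq_le {a η ρ : ℝ} (ha : 0 ≤ a) (hη : 0 ≤ η) (hρ : 0 ≤ ρ)
    (h : ρ ^ 2 ≤ a * η * (η + ρ)) : ρ ≤ (a + 1) * η := by
  by_contra! hlt
  have h1 : 0 ≤ (ρ - (a + 1) * η) * (ρ + η) := by
    have := sub_pos.2 hlt
    positivity
  have h2 : 0 < ρ := (by positivity : 0 ≤ (a + 1) * η).trans_lt hlt
  nlinarith [mul_pos (sub_pos.2 hlt) h2, mul_nonneg ha hη, mul_nonneg hη hη]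

/-- The monotonicity of the optimality system, tested with a solution. -/
theorem inner_add_inner_le_residual {A : E →L[ℝ] Y} {At : Y →L[ℝ] E} {B : F →L[ℝ] Y}
    {Bt : Y →L[ℝ] F} (hA : ∀ l u, inner ℝ (At l) u = inner ℝ l (A u))
    (hB : ∀ l v, inner ℝ (Bt l) v = inner ℝ l (B v)) {z z' : (E × E) × (F × F) × Y}
    (hz' : kktResidual A At B Bt z' = 0) :
    inner ℝ (z.1.2 - z'.1.2) (z.1.1 - z'.1.1) + inner ℝ (z.2.1.2 - z'.2.1.2) (z.2.1.1 - z'.2.1.1)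
      ≤ 3 * (‖kktResidual A At B Bt z‖ * ‖z - z'‖) := by
  have hy : kktResidual A At B Bt (z - z') = kktResidual A At B Bt z := by
    rw [map_sub, hz', sub_zero]
  rw [← hy]
  obtain ⟨⟨u, s⟩, ⟨v, t⟩, l⟩ := z
  obtain ⟨⟨u', s'⟩, ⟨v', t'⟩, l'⟩ := z'
  set ξ : (E × E) × (F × F) × Y := ((u, s), (v, t), l) - ((u', s'), (v', t'), l') with hξ
  set R := kktResidual A At B Bt ξ with hR
  -- Adjointness cancels the multiplier terms, leaving one product per component of the residual;
  -- this is the source of the factor 3.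
  have h1 : inner ℝ (s - s') (u - u') + inner ℝ (t - t') (v - v') =
      inner ℝ R.1 ξ.1.1 + inner ℝ R.2.1 ξ.2.1.1 + inner ℝ ξ.2.2 R.2.2 := by
    rw [hR, kktResidual_apply]
    simp only [hξ, Prod.mk_sub_mk, inner_sub_left (𝕜 := ℝ) (s - s'),
      inner_add_left (𝕜 := ℝ) (t - t'), hA, hB, inner_sub_right (𝕜 := ℝ) (l - l')]
    ring
  have b1 : ‖R.1‖ ≤ ‖R‖ := norm_fst_le R
  have b2 : ‖R.2.1‖ ≤ ‖R‖ := (norm_fst_le R.2).trans (norm_snd_le R)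
  have b3 : ‖R.2.2‖ ≤ ‖R‖ := (norm_snd_le R.2).trans (norm_snd_le R)
  have c1 : ‖ξ.1.1‖ ≤ ‖ξ‖ := (norm_fst_le ξ.1).trans (norm_fst_le ξ)
  have c2 : ‖ξ.2.1.1‖ ≤ ‖ξ‖ := (norm_fst_le ξ.2.1).trans ((norm_fst_le ξ.2).trans (norm_snd_le ξ))
  have c3 : ‖ξ.2.2‖ ≤ ‖ξ‖ := (norm_snd_le ξ.2).trans (norm_snd_le ξ)
  have d1 := (real_inner_le_norm R.1 ξ.1.1).trans
    (mul_le_mul b1 c1 (norm_nonneg _) (norm_nonneg _))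
  have d2 := (real_inner_le_norm R.2.1 ξ.2.1.1).trans
    (mul_le_mul b2 c2 (norm_nonneg _) (norm_nonneg _))
  have d3 := (real_inner_le_norm ξ.2.2 R.2.2).trans
    (mul_le_mul c3 b3 (norm_nonneg _) (norm_nonneg _))
  change inner ℝ (s - s') (u - u') + inner ℝ (t - t') (v - v') ≤ _
  rw [h1]
  linarith [mul_comm ‖ξ‖ ‖R‖]

theorem le_norm_sub_of_sq_le_inner {x y : E × E} {ρ : ℝ}
    (h : ρ ^ 2 ≤ inner ℝ (x.2 - y.2) (x.1 - y.1)) : ρ ≤ ‖x - y‖ := by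
  refine le_of_sq_le_sq ?_ (norm_nonneg _)
  refine h.trans ((real_inner_le_norm _ _).trans ?_)
  rw [sq]
  exact mul_le_mul (norm_snd_le (x - y)) (norm_fst_le (x - y)) (norm_nonneg _) (norm_nonneg _)

variable [FiniteDimensional ℝ E] [FiniteDimensional ℝ F] [FiniteDimensional ℝ Y]

/-- The local error bound for an optimality system whose two graphs have polyhedral models. -/
theorem kktResidual_error_bound {A : E →L[ℝ] Y} {At : Y →L[ℝ] E} {B : F →L[ℝ] Y}
    {Bt : Y →L[ℝ] F} (hA : ∀ l u, inner ℝ (At l) u = inner ℝ l (A u))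
    (hB : ∀ l v, inner ℝ (Bt l) v = inner ℝ l (B v)) {D : Set (E × E)} {D' : Set (F × F)}
    {z₀ : (E × E) × (F × F) × Y} (hD : HasPolyhedralModel D z₀.1)
    (hD' : HasPolyhedralModel D' z₀.2.1) (hz₀ : kktResidual A At B Bt z₀ = 0) :
    ∃ κ : ℝ, 0 ≤ κ ∧ ∃ ε : ℝ, 0 < ε ∧ ∀ z : (E × E) × (F × F) × Y, z.1 ∈ D → z.2.1 ∈ D' →
      ‖z - z₀‖ < ε → ∃ z' : (E × E) × (F × F) × Y, z'.1 ∈ D ∧ z'.2.1 ∈ D' ∧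
        kktResidual A At B Bt z' = 0 ∧ ‖z - z'‖ ≤ κ * ‖kktResidual A At B Bt z‖ := by
  obtain ⟨S, hS, hSD, hpS, L, hL, ε, hε, H⟩ := hD
  obtain ⟨S', hS', hSD', hpS', L', hL', ε', hε', H'⟩ := hD'
  set T := kktResidual A At B Bt
  obtain ⟨κ, hκ, δ, hδ, hreg⟩ := IsPolyUnion.local_error_bound
    ((hS.preimage (LinearMap.fst ℝ (E × E) ((F × F) × Y))).inter
      (hS'.preimage ((LinearMap.fst ℝ (F × F) Y).comp (LinearMap.snd ℝ (E × E) ((F × F) × Y)))))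
    T hz₀
  set M := max L L'
  have hM : 0 ≤ M := hL.trans (le_max_left _ _)
  set c := max κ (M + κ * ‖T‖ * M)
  have hc : 0 ≤ c := hκ.trans (le_max_left _ _)
  -- The radius `δ / (1 + M)` keeps the projection of `z` onto the models within `δ` of `z₀`.
  refine ⟨c * (1 + (6 * c + 1)), by positivity, min (min ε ε') (δ / (1 + M)),
    lt_min (lt_min hε hε') (by positivity), fun z hz hz' hzε => ?_⟩
  have hzε1 : ‖z - z₀‖ < ε := hzε.trans_le ((min_le_left _ _).trans (min_le_left _ _))
  have hzε2 : ‖z - z₀‖ < ε' := hzε.trans_le ((min_le_left _ _).trans (min_le_right _ _))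
  have hzδ : (1 + M) * ‖z - z₀‖ < δ := by
    rw [mul_comm]
    exact (lt_div_iff₀ (by positivity)).1 (hzε.trans_le (min_le_right _ _))
  have hn1 : ‖z.1 - z₀.1‖ ≤ ‖z - z₀‖ := norm_fst_le (z - z₀)
  have hn2 : ‖z.2.1 - z₀.2.1‖ ≤ ‖z - z₀‖ :=
    (norm_fst_le (z - z₀).2).trans (norm_snd_le (z - z₀))
  obtain ⟨q, hq, ρ, hρ, hzq, hmono⟩ := H z.1 hz (hn1.trans_lt hzε1)
  obtain ⟨q', hq', ρ', hρ', hzq', hmono'⟩ := H' z.2.1 hz' (hn2.trans_lt hzε2)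
  -- Testing the pairing with the base point, which belongs to the model, bounds `ρ` a priori.
  have hρM : ρ ≤ ‖z - z₀‖ := (le_norm_sub_of_sq_le_inner (hmono _ hpS)).trans hn1
  have hρM' : ρ' ≤ ‖z - z₀‖ := (le_norm_sub_of_sq_le_inner (hmono' _ hpS')).trans hn2
  have hzw : ∀ σ, ρ ≤ σ → ρ' ≤ σ → ‖z - (q, q', z.2.2)‖ ≤ M * σ := fun σ h1 h2 => by
    have hσ : 0 ≤ σ := hρ.trans h1
    refine max_le (hzq.trans ?_) (max_le (hzq'.trans ?_) ?_)
    · exact mul_le_mul (le_max_left _ _) h1 hρ hM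
    · exact mul_le_mul (le_max_right _ _) h2 hρ' hM
    · change ‖z.2.2 - z.2.2‖ ≤ _
      rw [sub_self, norm_zero]
      positivity
  obtain ⟨z', ⟨hz'S, hz'S'⟩, hTz', hwz'⟩ := hreg (q, q', z.2.2) ⟨hq, hq'⟩ (by
    have h1 := norm_sub_le_norm_sub_add_norm_sub (q, q', z.2.2) z z₀
    rw [norm_sub_rev (q, q', z.2.2) z] at h1
    linarith [hzw _ hρM hρM'])
  refine ⟨z', hSD hz'S, hSD' hz'S', hTz', ?_⟩
  have h1 := hzw (ρ + ρ') (by linarith) (by linarith)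
  have h2 : ‖T (q, q', z.2.2)‖ ≤ ‖T z‖ + ‖T‖ * (M * (ρ + ρ')) := by
    have h3 : T (q, q', z.2.2) = T z - T (z - (q, q', z.2.2)) := by rw [map_sub]; abel
    rw [h3]
    refine (norm_sub_le _ _).trans (add_le_add_right ((T.le_opNorm _).trans ?_) _)
    gcongr
  have h3 : ‖z - z'‖ ≤ c * (‖T z‖ + (ρ + ρ')) := by
    have h4 := norm_sub_le_norm_sub_add_norm_sub z (q, q', z.2.2) z'
    have h5 := mul_le_mul_of_nonneg_left h2 hκ
    have h6 := mul_le_mul_of_nonneg_right (le_max_left κ (M + κ * ‖T‖ * M)) (norm_nonneg (T z))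
    have h7 := mul_le_mul_of_nonneg_right (le_max_right κ (M + κ * ‖T‖ * M))
      (add_nonneg hρ hρ')
    linarith
  have h4 := inner_add_inner_le_residual hA hB (z := z) hTz'
  have h5 := hmono _ hz'S
  have h6 := hmono' _ hz'S'
  have h7 := mul_le_mul_of_nonneg_left h3 (norm_nonneg (T z))
  -- Here `(ρ + ρ') ^ 2 ≤ 2 * (ρ ^ 2 + ρ' ^ 2)`, and the pairing with `z'` is at most `3 * c * ‖T z‖
  -- * (‖T z‖ + (ρ + ρ'))`, hence `a = 6 * c`.
  have h8 : ρ + ρ' ≤ (6 * c + 1) * ‖T z‖ :=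
    le_mul_of_sq_le (by positivity) (norm_nonneg _) (by positivity) (by
      change ρ ^ 2 ≤ inner ℝ (z.1.2 - z'.1.2) (z.1.1 - z'.1.1) at h5
      change ρ' ^ 2 ≤ inner ℝ (z.2.1.2 - z'.2.1.2) (z.2.1.1 - z'.2.1.1) at h6
      nlinarith [sq_nonneg (ρ - ρ')])
  have h9 := mul_le_mul_of_nonneg_left h8 hc
  linarith

end Saddle

/-! ### From the lifted error bound to metric subregularity of the KKT mapping -/

theorem inner_toEuclideanLin_transpose {m n : Type*} [Fintype m] [Fintype n] [DecidableEq m]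
    [DecidableEq n] (M : Matrix m n ℝ) (l : EuclideanSpace ℝ m) (u : EuclideanSpace ℝ n) :
    inner ℝ (Matrix.toEuclideanLin M.transpose l) u = inner ℝ l (Matrix.toEuclideanLin M u) := by
  rw [← Matrix.conjTranspose_eq_transpose_of_trivial,
    Matrix.toEuclideanLin_conjTranspose_eq_adjoint, LinearMap.adjoint_inner_left]

/-- Metric subregularity from a local error bound on the graph. -/
theorem isMetricallySubregularAt_of_error_bound {X Y : Type*} [PseudoMetricSpace X]
    [PseudoMetricSpace Y] {Ψ : X → Set Y} {x₀ : X} {y₀ : Y} (h₀ : y₀ ∈ Ψ x₀) {κ δ : ℝ}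
    (hκ : 0 ≤ κ) (hδ : 0 < δ) (H : ∀ x y, y ∈ Ψ x → dist x x₀ < δ → dist y y₀ < δ →
      ∃ x', y₀ ∈ Ψ x' ∧ dist x x' ≤ κ * dist y y₀) : IsMetricallySubregularAt Ψ x₀ y₀ := by
  have hκ1 : 0 < κ + 1 := by positivity
  refine ⟨h₀, κ + 1, hκ1, δ, hδ, fun x hx => ?_⟩
  have hne : ENNReal.ofReal (κ + 1) ≠ 0 := by simpa using hκ1
  rw [mul_comm, ← ENNReal.div_le_iff hne ENNReal.ofReal_ne_top, Metric.le_infEDist]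
  intro y hy
  rw [ENNReal.div_le_iff hne ENNReal.ofReal_ne_top, edist_comm y₀ y, edist_dist y y₀, mul_comm,
    ← ENNReal.ofReal_mul hκ1.le]
  -- If `y` is at distance at least `δ` from `y₀`, then `x₀` itself is a close enough solution; this
  -- and positivity account for `κ + 1`.
  have key : ∃ x', y₀ ∈ Ψ x' ∧ dist x x' ≤ (κ + 1) * dist y y₀ := by
    by_cases hyδ : dist y y₀ < δ
    · obtain ⟨x', hx', h⟩ := H x y hy hx hyδ
      exact ⟨x', hx', h.trans (by nlinarith [dist_nonneg (x := y) (y := y₀)])⟩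
    · refine ⟨x₀, h₀, (Metric.mem_ball.1 hx).le.trans ?_⟩
      nlinarith [mul_nonneg hκ (dist_nonneg (x := y) (y := y₀))]
  obtain ⟨x', hx', h⟩ := key
  exact (Metric.infEDist_le_edist_of_mem (show x' ∈ {z | y₀ ∈ Ψ z} from hx')).trans
    ((edist_dist x x').trans_le (ENNReal.ofReal_le_ofReal h))

theorem norm_le_add_of_withLp {E F : Type*} [SeminormedAddCommGroup E]
    [SeminormedAddCommGroup F] (x : WithLp 2 (E × F)) : ‖x‖ ≤ ‖x.fst‖ + ‖x.snd‖ := by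
  rw [WithLp.prod_norm_eq_of_L2, Real.sqrt_le_left (by positivity)]
  nlinarith [norm_nonneg x.fst, norm_nonneg x.snd]

theorem norm_fst_le_of_withLp {E F : Type*} [SeminormedAddCommGroup E]
    [SeminormedAddCommGroup F] (x : WithLp 2 (E × F)) : ‖x.fst‖ ≤ ‖x‖ := by
  rw [WithLp.prod_norm_eq_of_L2]
  exact Real.le_sqrt_of_sq_le (le_add_of_nonneg_right (sq_nonneg _))

theorem norm_snd_le_of_withLp {E F : Type*} [SeminormedAddCommGroup E]
    [SeminormedAddCommGroup F] (x : WithLp 2 (E × F)) : ‖x.snd‖ ≤ ‖x‖ := by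
  rw [WithLp.prod_norm_eq_of_L2]
  exact Real.le_sqrt_of_sq_le (le_add_of_nonneg_left (sq_nonneg _))

/-- Metric subregularity of the KKT mapping when both subdifferential graphs have polyhedral
models. -/
theorem kktMap_isMetricallySubregularAt {n d : ℕ} (W : Matrix (Fin n) (Fin n) ℝ)
    (f g : Fin n → EuclideanSpace ℝ (Fin d) → WithTop ℝ)
    (hf : ∀ p : StackSpace n d × StackSpace n d, p.2 ∈ subdiff (separableSum f) p.1 →
      HasPolyhedralModel {p | p.2 ∈ subdiff (separableSum f) p.1} p)
    (hg : ∀ p : StackSpace n d × StackSpace n d, p.2 ∈ subdiff (separableSum g) p.1 →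
      HasPolyhedralModel {p | p.2 ∈ subdiff (separableSum g) p.1} p)
    {w₀ : KKTSpace n d} (hw₀ : w₀ ∈ kktSolutions W f g) :
    IsMetricallySubregularAt (kktMap W f g) w₀ 0 := by
  set A := LinearMap.toContinuousLinearMap (Matrix.toEuclideanLin (matA d W))
  set At := LinearMap.toContinuousLinearMap (Matrix.toEuclideanLin (matA d W).transpose)
  set B := LinearMap.toContinuousLinearMap (Matrix.toEuclideanLin (matB d W))
  set Bt := LinearMap.toContinuousLinearMap (Matrix.toEuclideanLin (matB d W).transpose)
  have hkkt : ∀ w y : KKTSpace n d, y ∈ kktMap W f g w ↔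
      ∃ s ∈ subdiff (separableSum f) w.fst, ∃ t ∈ subdiff (separableSum g) w.snd.fst,
        y.fst = s - At w.snd.snd ∧ y.snd.fst = t + Bt w.snd.snd ∧
        y.snd.snd = A w.fst - B w.snd.fst := fun w y => Iff.rfl
  have hsol : 0 ∈ kktMap W f g w₀ := hw₀
  obtain ⟨s₀, hs₀, t₀, ht₀, e1, e2, e3⟩ := (hkkt w₀ 0).1 hsol
  -- A value `y` of the KKT mapping at `w` determines the subgradients, so `Φ (w, y)` is the lifted
  -- point; its continuity makes the lift close to the base point when `w` and `y` are close to `w₀`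
  -- and `0`.
  let Φ : KKTSpace n d × KKTSpace n d → (StackSpace n d × StackSpace n d) ×
      (StackSpace n d × StackSpace n d) × MultSpace n d := fun p =>
    ((p.1.fst, p.2.fst + At p.1.snd.snd), (p.1.snd.fst, p.2.snd.fst - Bt p.1.snd.snd),
      p.1.snd.snd)
  have hΦ : Continuous Φ := by fun_prop
  have hΦ0 : Φ (w₀, 0) = ((w₀.fst, s₀), (w₀.snd.fst, t₀), w₀.snd.snd) := by
    have h1 : (0 : KKTSpace n d).fst + At w₀.snd.snd = s₀ := by rw [e1]; abel
    have h2 : (0 : KKTSpace n d).snd.fst - Bt w₀.snd.snd = t₀ := by rw [e2]; abel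
    simp only [Φ, h1, h2]
  have hres : ∀ w y, kktResidual A At B Bt (Φ (w, y)) =
      (y.fst, y.snd.fst, A w.fst - B w.snd.fst) := fun w y => by
    simp only [kktResidual_apply, Φ, add_sub_cancel_right, sub_add_cancel]
  obtain ⟨κ, hκ, ε, hε, H⟩ := kktResidual_error_bound (A := A) (At := At) (B := B) (Bt := Bt)
    (inner_toEuclideanLin_transpose _) (inner_toEuclideanLin_transpose _)
    (z₀ := Φ (w₀, 0)) (by rw [hΦ0]; exact hf _ hs₀) (by rw [hΦ0]; exact hg _ ht₀)
    (by rw [hres, ← e3]; rfl)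
  obtain ⟨δ, hδ, hΦδ⟩ := Metric.continuous_iff.1 hΦ (w₀, 0) ε hε
  -- The Euclidean norm of a triple is at most the sum of three norms, each bounded by the maximum
  -- norm of the lifted space.
  refine isMetricallySubregularAt_of_error_bound hsol (κ := 3 * κ) (by positivity) hδ
    fun w y hy hw hyδ => ?_
  obtain ⟨s, hs, t, ht, h1, h2, h3⟩ := (hkkt w y).1 hy
  have hs' : s = y.fst + At w.snd.snd := by rw [h1]; abel
  have ht' : t = y.snd.fst - Bt w.snd.snd := by rw [h2]; abel
  obtain ⟨z, hz1, hz2, hz0, hz⟩ := H (Φ (w, y)) (by rwa [hs'] at hs) (by rwa [ht'] at ht) (by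
    rw [← dist_eq_norm]
    exact hΦδ _ (max_lt hw hyδ))
  rw [kktResidual_apply, Prod.mk_eq_zero, Prod.mk_eq_zero] at hz0
  refine ⟨WithLp.toLp 2 (z.1.1, WithLp.toLp 2 (z.2.1.1, z.2.2)), (hkkt _ 0).2
    ⟨z.1.2, hz1, z.2.1.2, hz2, hz0.1.symm, hz0.2.1.symm, hz0.2.2.symm⟩, ?_⟩
  have hy3 : ‖kktResidual A At B Bt (Φ (w, y))‖ ≤ dist y 0 := by
    rw [hres, ← h3, dist_zero_right]
    exact max_le (norm_fst_le_of_withLp y) (max_le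
      ((norm_fst_le_of_withLp y.snd).trans (norm_snd_le_of_withLp y))
      ((norm_snd_le_of_withLp y.snd).trans (norm_snd_le_of_withLp y)))
  have hz' := hz.trans (mul_le_mul_of_nonneg_left hy3 hκ)
  have d1 : ‖w.fst - z.1.1‖ ≤ ‖Φ (w, y) - z‖ :=
    (norm_fst_le (Φ (w, y) - z).1).trans (norm_fst_le (Φ (w, y) - z))
  have d2 : ‖w.snd.fst - z.2.1.1‖ ≤ ‖Φ (w, y) - z‖ :=
    (norm_fst_le (Φ (w, y) - z).2.1).trans ((norm_fst_le (Φ (w, y) - z).2).trans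
      (norm_snd_le (Φ (w, y) - z)))
  have d3 : ‖w.snd.snd - z.2.2‖ ≤ ‖Φ (w, y) - z‖ :=
    (norm_snd_le (Φ (w, y) - z).2).trans (norm_snd_le (Φ (w, y) - z))
  rw [dist_eq_norm]
  set v : KKTSpace n d := w - WithLp.toLp 2 (z.1.1, WithLp.toLp 2 (z.2.1.1, z.2.2))
  have c0 := norm_le_add_of_withLp v
  have c1 := norm_le_add_of_withLp v.snd
  change ‖v.fst‖ ≤ _ at d1
  change ‖v.snd.fst‖ ≤ _ at d2
  change ‖v.snd.snd‖ ≤ _ at d3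
  linarith

theorem proposition4 {n d : ℕ} (G : SimpleGraph (Fin n)) (hG : G.Connected)
    (W : Matrix (Fin n) (Fin n) ℝ) (hW : IsMixingMatrix G W)
    (f g : Fin n → EuclideanSpace ℝ (Fin d) → WithTop ℝ)
    (hf : ∀ i, IsConvexFun (f i)) (hg : ∀ i, IsConvexFun (g i))
    (h : ((∀ i, IsSmoothStronglyConvex (f i)) ∧ (∀ i, IsPLQ (g i))) ∨
      ((∀ i, IsPLQ (f i)) ∧ (∀ i, IsPLQ (g i))) ∨
      ((∀ i, IsSmoothStronglyConvex (f i)) ∧ (∀ i, IsSmoothStronglyConvex (g i)))) :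
    ∀ wbar ∈ kktSolutions W f g, IsMetricallySubregularAt (kktMap W f g) wbar 0 := by
  have hmodel : ∀ k : Fin n → EuclideanSpace ℝ (Fin d) → WithTop ℝ, (∀ i, IsConvexFun (k i)) →
      ((∀ i, IsSmoothStronglyConvex (k i)) ∨ (∀ i, IsPLQ (k i))) →
      ∀ p : StackSpace n d × StackSpace n d, p.2 ∈ subdiff (separableSum k) p.1 →
        HasPolyhedralModel {p | p.2 ∈ subdiff (separableSum k) p.1} p := by
    intro k hk hcase p hp
    refine hasPolyhedralModel_separableSum fun i => ?_
    have hpi := mem_subdiff_separableSum.1 hp i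
    rcases hcase with hs | hq
    · exact (hs i).hasPolyhedralModel (p := (_, _)) hpi
    · exact (hq i).hasPolyhedralModel (hk i) (p := (_, _)) hpi
  intro wbar hwbar
  exact kktMap_isMetricallySubregularAt W f g (hmodel f hf (by tauto)) (hmodel g hg (by tauto))
    hwbar
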